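/- Let $\mathbb F$ be a field, let $n,w\ge 1$ and $d\ge 0$ be integers, and put $N=2^n$. Let $\omega\in\mathbb F^{\times}$ have multiplicative order at least $(Ndw^2)^2$ (infinite order is allowed). **roABPs.** A read-once oblivious algebraic branching program (roABP) reading $m$ variables in the order $Z_1,\dots,Z_m$ is a layered directed graph with layers $V_0=\{s\},V_1,\dots,V_{m-1},V_m=\{t\}$ whose edges go from $V_{i-1}$ to $V_i$ and are labelled by univariate polynomials in $Z_i$. It computes the sum, over all $s\to t$ paths, of the product of the edge labels. It has width at most $w$ if $|V_i|\le w$ for all $i$, and degree $d$ if all labels have degree at most $d$. "Width-$w$" below means width at most $w$. **Coefficient vectors.** Let $X_b$ $(b\in\{0,1\}^n)$ be $N$ variables, indexed by the multilinear monomials $x_b=\prod_i x_i^{b_i}$, and listed as $X_1,\dots,X_N$ with $X_b=X_{1+\sum_i b_i2^{i-1}}$. For a permutation $\sigma$ of $[n]$ let $\prec_\sigma$ be the order on the variables $X_b$ in which $X_b$ has position $1+\sum_i b_{\sigma(i)}2^{i-1}$, that is, the lexicographic order on multilinear monomials induced by the order $x_{\sigma(1)},\dots,x_{\sigma(n)}$,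 with $x_{\sigma(n)}$ most significant; $\prec_{\mathrm{id}}$ is the order $X_1,\dots,X_N$. The orders $\prec_\sigma$ are called monomial-compatible. A set $\mathcal C$ of multilinear polynomials in $\mathbb F[x_1,\dots,x_n]$ is a succinct hitting set for a class $\mathcal D\subseteq\mathbb F[X_b: b\in\{0,1\}^n]$ if every $D\in\mathcal D$ is non-zero if and only if $D(\mathbf{coeff}(f))\ne 0$ for some $f\in\mathcal C$, where $\mathbf{coeff}(f)=(\text{coefficient of }x_b\text{ in }f)_b$. A polynomial map $\mathcal G=(\mathcal G_b)_b$, $\mathcal G_b\in\mathbb F[y_1,\dots,y_{n+1}]$, is a $\mathcal C$-succinct generator for $\mathcal D$ if $\sum_b\mathcal G_b(\alpha)x_b\in\mathcal C$ for every $\alpha\in\mathbb F^{n+1}$, and every $D\in\mathcal D$ is non-zero if and only if $D(\mathcal G(y))$ is a non-zero polynomial in $y$. **The Forbes–Shpilka generator.** For distinct $\beta_1,\dots,\beta_{w^2}\in\mathbb F$ let $p_1,\dots,p_{w^2}$ be the Lagrange interpolation polynomials, $\deg p_i<w^2$, $p_i(\beta_i)=1$ and $p_i(\beta_j)=0$ for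 $j\neq i$, and write $p_{\ell_0}(t)=t$. Define $$\mathcal G^{\mathrm{FS}}_b(y)=\sum_{\ell_1,\dots,\ell_n\in[w^2]}\ \prod_{i=1}^n\Big((1-b_i)\,p_{\ell_{i-1}}(\omega^{\ell_i}y_i)+b_i\,p_{\ell_{i-1}}\big((\omega^{\ell_i}y_i)^{2^{i-1}dw^2}\big)\Big)\cdot p_{\ell_n}(y_{n+1}),$$ $$P^{\mathrm{FS}}(x,y)=\sum_{\ell_1,\dots,\ell_n\in[w^2]}\ \prod_{i=1}^n\Big(p_{\ell_{i-1}}(\omega^{\ell_i}y_i)+x_i\,p_{\ell_{i-1}}\big((\omega^{\ell_i}y_i)^{2^{i-1}dw^2}\big)\Big)\cdot p_{\ell_n}(y_{n+1}).$$ For a permutation $\sigma$ of $[n]$ let $P^{\mathrm{FS}}_\sigma(x,y)=P^{\mathrm{FS}}(x_{\sigma(1)},\dots,x_{\sigma(n)},y)$. **Theorem.** For all distinct $\beta_1,\dots,\beta_{w^2}\in\mathbb F$: 1. $P^{\mathrm{FS}}$ is multilinear in $x$ with $\mathbf{coeff}_x(P^{\mathrm{FS}})=\mathcal G^{\mathrm{FS}}$,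 that is, $P^{\mathrm{FS}}=\sum_b\mathcal G^{\mathrm{FS}}_b(y)\,x_b$. 2. For every $\alpha\in\mathbb F^{n+1}$, $P^{\mathrm{FS}}(x,\alpha)$ is computed by a width-$w^2$, degree-$1$ roABP reading $x_1,\dots,x_n$ in this order. 3. $\mathcal G^{\mathrm{FS}}$ is a $\mathcal C$-succinct generator for the class of polynomials computed by width-$w$, degree-$d$ roABPs in the order $X_1,\dots,X_N$, where $\mathcal C$ is the class of polynomials computed by width-$w^2$, degree-$1$ roABPs in the order $x_1,\dots,x_n$. 4. For every permutation $\sigma$ of $[n]$, each $P^{\mathrm{FS}}_\sigma(x,\alpha)$ is computed by a width-$w^2$, degree-$1$ roABP in the order $x_{\sigma(1)},\dots,x_{\sigma(n)}$, and $\{P^{\mathrm{FS}}_\sigma(x,\alpha):\alpha\in\mathbb F^{n+1}\}$ is a succinct hitting set for width-$w$, degree-$d$ roABPs in the order $\prec_\sigma$. The union of these sets over the $n!$ permutations $\sigma$ is a succinct hitting set for the width-$w$, degree-$d$ roABPs reading the $N$ variables in any monomial-compatible order. Consequently (for $\omega$ as above), the class of polynomials computed by width-$w^2$, degree-$1$ roABPs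 in the order $x_1,\dots,x_n$ is a succinct hitting set for width-$w$, degree-$d$ roABPs in the order $X_1,\dots,X_N$, and the class of polynomials computed by width-$w^2$, degree-$1$ roABPs in some order of $x_1,\dots,x_n$ is a succinct hitting set for width-$w$, degree-$d$ roABPs in any monomial-compatible order of the $N$ variables. -/

import Mathlib

namespace SuccinctROABP

noncomputable section

/-- A read-once oblivious algebraic branching program reading `m` variables: a layered graph with
layers `V_0, …, V_m`, where `V_i` is `Fin (size i)`, the first and last layer are single vertices
(source and sink), and every edge from `V_i` to `V_{i+1}` carries a univariate polynomial.
An absent edge is an edge with label `0`. -/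
structure ROABP (F : Type*) [Field F] (m : ℕ) where
  size : Fin (m + 1) → ℕ
  size_source : size 0 = 1
  size_sink : size (Fin.last m) = 1
  label : ∀ i : Fin m, Fin (size i.castSucc) → Fin (size i.succ) → Polynomial F

/-- The polynomial computed when the `i`-th layer of edges reads the variable `ord i`:
the sum over all source-sink paths (a choice of one vertex in each layer) of the product of the
edge labels. -/
def ROABP.poly {F : Type*} [Field F] {m : ℕ} {V : Type*} (B : ROABP F m) (ord : Fin m ≃ V) :
    MvPolynomial V F :=
  ∑ v : (∀ i : Fin (m + 1), Fin (B.size i)), ∏ i : Fin m,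
    Polynomial.aeval (MvPolynomial.X (ord i) : MvPolynomial V F)
      (B.label i (v i.castSucc) (v i.succ))

/-- The class of polynomials computed by roABPs of width at most `w`, with edge labels of degree
at most `d`, reading the variables in the order `ord 0, ord 1, …`. -/
def roABPClass (F : Type*) [Field F] {m : ℕ} {V : Type*} (w d : ℕ) (ord : Fin m ≃ V) :
    Set (MvPolynomial V F) :=
  {f | ∃ B : ROABP F m, (∀ i, B.size i ≤ w) ∧ (∀ i u v, (B.label i u v).natDegree ≤ d) ∧
    B.poly ord = f}

/-- The exponent vector of the multilinear monomial `x_b = ∏ i, x_i ^ b_i`, `b ∈ {0,1}^n`. -/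
def expo {n : ℕ} (b : Fin n → Fin 2) : Fin n →₀ ℕ :=
  Finsupp.equivFunOnFinite.symm (fun i => (b i : ℕ))

/-- The coefficient vector of a polynomial with respect to the multilinear monomials. -/
def coeffVec {R : Type*} [CommSemiring R] {n : ℕ} (f : MvPolynomial (Fin n) R) :
    (Fin n → Fin 2) → R :=
  fun b => MvPolynomial.coeff (expo b) f

/-- The multilinear polynomial `∑_b c_b x_b` with coefficient vector `c`. -/
def ofCoeffVec {R : Type*} [CommSemiring R] {n : ℕ} (c : (Fin n → Fin 2) → R) :
    MvPolynomial (Fin n) R :=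
  ∑ b, MvPolynomial.monomial (expo b) (c b)

/-- The set `C` (a set of multilinear polynomials) is a succinct hitting set for the class `D` of
polynomials in `2^n` variables, the variables being indexed by the multilinear monomials. -/
def IsSuccinctHittingSet {F : Type*} [Field F] {n : ℕ} (C : Set (MvPolynomial (Fin n) F))
    (D : Set (MvPolynomial (Fin n → Fin 2) F)) : Prop :=
  (∀ f ∈ C, f ∈ MvPolynomial.restrictDegree (Fin n) F 1) ∧
  ∀ P ∈ D, (P ≠ 0 ↔ ∃ f ∈ C, MvPolynomial.eval (coeffVec f) P ≠ 0)

/-- The polynomial map `G : F^l → F^{2^n}` is a generator for the class `D`. -/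
def IsGenerator {F : Type*} [Field F] {n l : ℕ} (D : Set (MvPolynomial (Fin n → Fin 2) F))
    (G : (Fin n → Fin 2) → MvPolynomial (Fin l) F) : Prop :=
  ∀ P ∈ D, (P ≠ 0 ↔ MvPolynomial.bind₁ G P ≠ 0)

/-- The polynomial map `G : F^l → F^{2^n}` is a `C`-succinct generator for `D`, where `C` is a set
of multilinear polynomials. -/
def IsSuccinctGenerator {F : Type*} [Field F] {n l : ℕ} (C : Set (MvPolynomial (Fin n) F))
    (D : Set (MvPolynomial (Fin n → Fin 2) F))
    (G : (Fin n → Fin 2) → MvPolynomial (Fin l) F) : Prop :=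
  (∀ f ∈ C, f ∈ MvPolynomial.restrictDegree (Fin n) F 1) ∧
  (∀ α : Fin l → F, MvPolynomial.map (MvPolynomial.eval α) (ofCoeffVec G) ∈ C) ∧
  IsGenerator D G

/-- The order on the multilinear monomials (equivalently, on the variables `X_b`) that is
lexicographic with respect to the order `x_{σ 0}, …, x_{σ (n-1)}`, the last one being the most
significant: `x_b` has position `∑ i, b (σ i) * 2 ^ i`. For `σ = 1` this is the order
`X_1, …, X_N` under the identification of `[N]` with `{0,1}^n` by binary representation. -/
def monomialOrder {n : ℕ} (σ : Equiv.Perm (Fin n)) : Fin (2 ^ n) ≃ (Fin n → Fin 2) :=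
  finFunctionFinEquiv.symm.trans (Equiv.arrowCongr σ (Equiv.refl (Fin 2)))

theorem monomialOrder_symm_apply {n : ℕ} (σ : Equiv.Perm (Fin n)) (b : Fin n → Fin 2) :
    (((monomialOrder σ).symm b : Fin (2 ^ n)) : ℕ) = ∑ i, (b (σ i) : ℕ) * 2 ^ (i : ℕ) := by
  simp [monomialOrder, finFunctionFinEquiv]

/-- A variable order is monomial-compatible if it is the lexicographic order on the multilinear
monomials induced by some order of `x_1, …, x_n`. -/
def IsMonomialCompatible {n : ℕ} (ord : Fin (2 ^ n) ≃ (Fin n → Fin 2)) : Prop :=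
  ∃ σ : Equiv.Perm (Fin n), ord = monomialOrder σ

section ForbesShpilka

variable {F : Type*} [Field F] {n : ℕ} (w d : ℕ) (ω : F) (β : Fin (w ^ 2) → F)

/-- The univariate polynomials `p_{ℓ_0}, p_{ℓ_1}, …, p_{ℓ_n}`: `p_{ℓ_0}(t) = t`, and `p_{ℓ_i}` is
the Lagrange interpolation polynomial of the node `β_{ℓ_i}`. -/
def interp (ℓ : Fin n → Fin (w ^ 2)) : Fin (n + 1) → Polynomial F :=
  Fin.cons Polynomial.X (fun j => Lagrange.basis Finset.univ β (ℓ j))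

/-- The linear form `ω ^ ℓ_i * y_i`; the elements of `[w^2]` are `1, …, w^2`. -/
def point (ℓ : Fin n → Fin (w ^ 2)) (i : Fin n) : MvPolynomial (Fin (n + 1)) F :=
  MvPolynomial.C (ω ^ ((ℓ i : ℕ) + 1)) * MvPolynomial.X i.castSucc

/-- `p_{ℓ_{i-1}} (ω ^ ℓ_i * y_i)`. -/
def loTerm (ℓ : Fin n → Fin (w ^ 2)) (i : Fin n) : MvPolynomial (Fin (n + 1)) F :=
  Polynomial.aeval (point w ω ℓ i) (interp w β ℓ i.castSucc)

/-- `p_{ℓ_{i-1}} ((ω ^ ℓ_i * y_i) ^ (2 ^ (i-1) * d * w^2))` (here `i` is counted from `0`). -/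
def hiTerm (ℓ : Fin n → Fin (w ^ 2)) (i : Fin n) : MvPolynomial (Fin (n + 1)) F :=
  Polynomial.aeval (point w ω ℓ i ^ (2 ^ (i : ℕ) * d * w ^ 2)) (interp w β ℓ i.castSucc)

/-- `p_{ℓ_n} (y_{n+1})`. -/
def lastTerm (ℓ : Fin n → Fin (w ^ 2)) : MvPolynomial (Fin (n + 1)) F :=
  Polynomial.aeval (MvPolynomial.X (Fin.last n) : MvPolynomial (Fin (n + 1)) F)
    (interp w β ℓ (Fin.last n))

/-- The Forbes–Shpilka generator, a polynomial map `F^{n+1} → F^{2^n}` with output coordinates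
indexed by `{0,1}^n`. -/
def genFS (b : Fin n → Fin 2) : MvPolynomial (Fin (n + 1)) F :=
  ∑ ℓ : Fin n → Fin (w ^ 2),
    (∏ i : Fin n, ((1 - ((b i : ℕ) : MvPolynomial (Fin (n + 1)) F)) * loTerm w ω β ℓ i
      + ((b i : ℕ) : MvPolynomial (Fin (n + 1)) F) * hiTerm w d ω β ℓ i))
    * lastTerm w β ℓ

/-- The polynomial `P^FS(x, y)`, as an element of `(F[y_1, …, y_{n+1}])[x_1, …, x_n]`. -/
def polyFS : MvPolynomial (Fin n) (MvPolynomial (Fin (n + 1)) F) :=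
  ∑ ℓ : Fin n → Fin (w ^ 2),
    (∏ i : Fin n, (MvPolynomial.C (loTerm w ω β ℓ i)
      + MvPolynomial.X i * MvPolynomial.C (hiTerm w d ω β ℓ i)))
    * MvPolynomial.C (lastTerm w β ℓ)

/-- The polynomial `P^FS(x, α)` with the variables `x_i` replaced by `x_{σ i}`. -/
def polyFSAt (σ : Equiv.Perm (Fin n)) (α : Fin (n + 1) → F) : MvPolynomial (Fin n) F :=
  MvPolynomial.rename σ (MvPolynomial.map (MvPolynomial.eval α) (polyFS w d ω β))

end ForbesShpilka

end

end SuccinctROABP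

/-!
The generator merges blocks of variables along the binary tree of the index set `{0,1}^n`. Write a
branching program in the order `X_1, …, X_N` as an entry of an ordered product of `w × w` matrices
`M_b(X_b)` of univariate polynomials (`ROABP.poly_eq_listProd`). Two neighbouring blocks whose
products along curves in one parameter are `A(x)` and `B(y)` are merged by substituting
`x = ω ^ ℓ α` and `y = (ω ^ ℓ α) ^ k`, where `k` exceeds the degrees (except possibly for `w = 1`,
where a nonzero product suffices), and by interpolating the `w ^ 2` results for the various `ℓ`,
which gives a block with a new single parameter.

What the merging preserves is the span of the matrix values of a block. By uniqueness of base-`k`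
digits, the coefficients of `A(z) B(z ^ k)` span all products `A(x) B(y)`
(`mul_mem_span_coeff_kroneckerMul`). These coefficients live in a space of dimension `w ^ 2`, so by
rank condensing (`finite_not_span_values`) they are spanned by the values at
`z = ω α, …, ω ^ (w ^ 2) α` for all but finitely many `α`. Working over the algebraic closure, one
`α` serves all the blocks of a level, and by induction on the level
(`exists_blockProd_mem_span`) every value of the whole matrix product lies in the span of its values
along the top curve; if the program vanished on that curve, it would vanish everywhere. As the
curves are the values of the generator (`aeval_genFS`), composing a nonzero program with the
generator gives a nonzero polynomial (`bind₁_genFS_ne_zero`).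

The degree of this composition in each seed variable is below the order of `ω`, so it is nonzero
at a point with coordinates in the base field (`exists_eval_genFS_ne_zero`). The summation indices
`ℓ_1, …, ℓ_n` of `P^FS` are the vertices of a path, which exhibits `P^FS(x, α)` as a branching
program of width `w ^ 2` (`map_polyFS_mem_roABPClass`). The other monomial-compatible orders are
obtained by renaming variables (`coeffVec_rename`).
-/

namespace SuccinctROABP

/-! ### Rank condensing along a geometric progression -/

section Condenser

open Finset

variable {K V : Type*} [Field K] [AddCommGroup V] [Module K V]

open Classical in
/-- The indices `k < T` at which the vector `v k` is not a combination of its predecessors. -/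
noncomputable def pivots (K : Type*) {V : Type*} [Field K] [AddCommGroup V] [Module K V]
    (v : ℕ → V) (T : ℕ) : Finset ℕ :=
  (range T).filter fun k => v k ∉ Submodule.span K (v '' Set.Iio k)

theorem linearIndepOn_pivots (v : ℕ → V) (T : ℕ) :
    LinearIndepOn K v (pivots K v T : Set ℕ) := by
  classical
  induction T with
  | zero => simp [pivots]
  | succ T ih =>
    by_cases h : v T ∈ Submodule.span K (v '' Set.Iio T)
    · have : pivots K v (T + 1) = pivots K v T := by
        simp [pivots, range_add_one, filter_insert, h]
      rwa [this]
    · have : pivots K v (T + 1) = insert T (pivots K v T) := by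
        simp [pivots, range_add_one, filter_insert, h]
      rw [this, coe_insert]
      refine ih.insert fun hT => h (Submodule.span_mono (Set.image_mono ?_) hT)
      intro k hk
      simp only [pivots, coe_filter, mem_range, Set.mem_ofPred_eq] at hk
      exact hk.1

theorem mem_span_pivots (v : ℕ → V) (T : ℕ) :
    ∀ k < T, v k ∈
      Submodule.span K (v '' (((pivots K v T).filter (· ≤ k) : Finset ℕ) : Set ℕ)) := by
  classical
  intro k
  induction k using Nat.strong_induction_on with
  | _ k ih =>
    intro hk
    by_cases h : v k ∈ Submodule.span K (v '' Set.Iio k)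
    · refine Submodule.span_le.2 ?_ h
      rintro _ ⟨j, hj, rfl⟩
      have hj : j < k := hj
      refine Submodule.span_mono (Set.image_mono ?_) (ih j hj (hj.trans hk))
      intro i hi
      simp only [coe_filter, Set.mem_ofPred_eq] at hi ⊢
      exact ⟨hi.1, hi.2.trans hj.le⟩
    · refine Submodule.subset_span ⟨k, ?_, rfl⟩
      simp [pivots, hk, h]

/-- Echelon coordinates of `v k` with respect to the pivot vectors. -/
theorem exists_pivot_coords (v : ℕ → V) (T k : ℕ) (hk : k < T) :
    ∃ a : ℕ → K, v k = ∑ j ∈ pivots K v T, a j • v j ∧ (∀ j, k < j → a j = 0) ∧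
      (k ∈ pivots K v T → a k = 1) := by
  classical
  by_cases h : k ∈ pivots K v T
  · refine ⟨Pi.single k 1, ?_, fun j hj => ?_, fun _ => by simp⟩
    · rw [sum_eq_single k] <;> simp +contextual [h]
    · simp [hj.ne']
  · obtain ⟨c, hc⟩ := Submodule.mem_span_image_finset_iff_exists_fun' K |>.1
      (mem_span_pivots (K := K) v T k hk)
    refine ⟨fun j => if j ≤ k then c j else 0, ?_, fun j hj => by simp [hj], fun h' => (h h').elim⟩
    rw [← hc, sum_filter]
    exact sum_congr rfl fun j _ => by by_cases hj : j ≤ k <;> simp [hj]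

/-- **Gabizon–Raz rank condensing.** If the powers `ω ^ k`, `k < T`, are distinct, then for all but
finitely many `α`, the values of the vector-valued polynomial `∑ k < T, z ^ k • v k` at the points
`ω α, ω ^ 2 α, …, ω ^ r α` span all of its coefficients, where `r` bounds the dimension. In echelon
coordinates the determinant of these values is a polynomial in `α` whose lowest-order coefficient
is a Vandermonde determinant. -/
theorem finite_not_span_values [FiniteDimensional K V] {r T : ℕ} (hr : Module.finrank K V ≤ r)
    {ω : K} (hω0 : ω ≠ 0) (hω : Set.InjOn (fun k : ℕ => ω ^ k) (Set.Iio T)) (v : ℕ → V) :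
    {α : K | ¬ ∀ k < T, v k ∈ Submodule.span K (Set.range fun ℓ : Fin r =>
      ∑ k ∈ range T, (ω ^ ((ℓ : ℕ) + 1) * α) ^ k • v k)}.Finite := by
  classical
  choose! a ha0 ha1 ha2 using exists_pivot_coords (K := K) v T
  set J := pivots K v T with hJ
  have hJT : ∀ j ∈ J, j < T := fun j hj => by simp [hJ, pivots] at hj; exact hj.1
  set s := #J with hs
  have hsr : s ≤ r := by
    have := (linearIndepOn_pivots (K := K) v T).fintype_card_le_finrank
    simp only [coe_sort_coe, Fintype.card_coe] at this
    exact this.trans hr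
  set κ : Fin s ↪o ℕ := J.orderEmbOfFin rfl with hκ
  have hκJ : ∀ i, κ i ∈ J := fun i => J.orderEmbOfFin_mem rfl i
  -- `z ^ j * h j` is the coordinate of the vector-valued polynomial along the pivot vector `v j`.
  let h : ℕ → Polynomial K := fun j =>
    ∑ k ∈ (range T).filter (j ≤ ·), Polynomial.C (a k j) * Polynomial.X ^ (k - j)
  have hval : ∀ z : K, ∑ k ∈ range T, z ^ k • v k =
      ∑ i : Fin s, (z ^ κ i * (h (κ i)).eval z) • v (κ i) := by
    intro z
    have e1 : ∀ f : ℕ → V, ∑ i : Fin s, f (κ i) = ∑ j ∈ J, f j := by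
      intro f
      rw [← J.map_orderEmbOfFin_univ rfl, sum_map]
      rfl
    rw [e1 (fun j => (z ^ j * (h j).eval z) • v j)]
    calc ∑ k ∈ range T, z ^ k • v k
        = ∑ k ∈ range T, ∑ j ∈ J, (z ^ k * a k j) • v j := by
          refine sum_congr rfl fun k hk => ?_
          conv_lhs => rw [ha0 k (mem_range.1 hk)]
          rw [smul_sum]
          simp [smul_smul]
      _ = ∑ j ∈ J, (∑ k ∈ range T, z ^ k * a k j) • v j := by
          rw [sum_comm]; simp [sum_smul]
      _ = _ := by
          refine sum_congr rfl fun j _ => ?_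
          congr 1
          simp only [h, Polynomial.eval_finsetSum, mul_sum, sum_filter]
          refine sum_congr rfl fun k hk => ?_
          split_ifs with hjk
          · simp only [Polynomial.eval_mul, Polynomial.eval_C, Polynomial.eval_pow,
              Polynomial.eval_X]
            rw [mul_comm (a k j), ← mul_assoc, ← pow_add, Nat.add_sub_cancel' hjk]
          · rw [ha1 k (mem_range.1 hk) j (not_le.1 hjk), Polynomial.eval_zero, mul_zero, mul_zero]
  have hh0 : ∀ j ∈ J, (h j).eval 0 = 1 := by
    intro j hj
    simp only [h, Polynomial.eval_finsetSum]
    rw [sum_eq_single j]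
    · simp [ha2 j (hJT j hj) hj]
    · intro k hk hkj
      have : k - j ≠ 0 := by
        have := (mem_filter.1 hk).2
        omega
      simp [this]
    · intro hj'
      simp [hJT j hj] at hj'
  let H : Matrix (Fin s) (Fin s) (Polynomial K) := Matrix.of fun ℓ i =>
    Polynomial.C ((ω ^ κ i) ^ ((ℓ : ℕ) + 1)) *
      (h (κ i)).comp (Polynomial.C (ω ^ ((ℓ : ℕ) + 1)) * Polynomial.X)
  have hdet : H.det ≠ 0 := by
    intro h0
    -- At `0` the matrix `H` is a Vandermonde matrix with scaled columns.
    have h1 : (H.map (Polynomial.evalRingHom (0 : K))).det = 0 := by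
      rw [← RingHom.mapMatrix_apply, ← RingHom.map_det, h0, map_zero]
    have h2 : H.map (Polynomial.evalRingHom (0 : K)) =
        Matrix.of fun ℓ i => ω ^ κ i * (Matrix.vandermonde fun i => ω ^ κ i).transpose ℓ i := by
      ext ℓ i
      simp [H, hh0 _ (hκJ i), pow_succ']
    rw [h2, Matrix.det_mul_row, Matrix.det_transpose] at h1
    rcases mul_eq_zero.1 h1 with h1 | h1
    · obtain ⟨i, -, hi⟩ := prod_eq_zero_iff.1 h1
      exact pow_ne_zero _ hω0 hi
    · refine Matrix.det_vandermonde_ne_zero_iff.2 ?_ h1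
      intro i j hij
      exact κ.injective (hω (hJT _ (hκJ i)) (hJT _ (hκJ j)) hij)
  refine ((Set.finite_singleton (0 : K)).union (H.det.rootSet_finite K)).subset ?_
  intro α hα
  by_contra hgood
  simp only [Set.mem_union, Set.mem_singleton_iff, not_or] at hgood
  obtain ⟨hα0, hroot⟩ := hgood
  have hroot : H.det.eval α ≠ 0 := by
    intro h0
    exact hroot (Polynomial.mem_rootSet.2 ⟨hdet, by simpa using h0⟩)
  refine hα ?_
  -- `M` holds the pivot coordinates of the values at `ω ^ (ℓ + 1) α`.
  let M : Matrix (Fin s) (Fin s) K := Matrix.of fun ℓ i =>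
    (ω ^ ((ℓ : ℕ) + 1) * α) ^ κ i * (h (κ i)).eval (ω ^ ((ℓ : ℕ) + 1) * α)
  have hM : M.det ≠ 0 := by
    have : M = Matrix.of fun ℓ i => α ^ κ i * (H.map (Polynomial.evalRingHom α)) ℓ i := by
      ext ℓ i
      simp only [M, H, Matrix.of_apply, Matrix.map_apply, Polynomial.coe_evalRingHom,
        Polynomial.eval_mul, Polynomial.eval_C, Polynomial.eval_comp, Polynomial.eval_X]
      rw [mul_pow, ← pow_mul, ← pow_mul, mul_comm (κ i)]
      ring
    rw [this, Matrix.det_mul_row, ← RingHom.mapMatrix_apply, ← RingHom.map_det]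
    exact mul_ne_zero (prod_ne_zero_iff.2 fun i _ => pow_ne_zero _ hα0) hroot
  set S := Submodule.span K (Set.range fun ℓ : Fin r =>
      ∑ k ∈ range T, (ω ^ ((ℓ : ℕ) + 1) * α) ^ k • v k) with hS
  have hpivot : ∀ i : Fin s, v (κ i) ∈ S := by
    intro i
    have : v (κ i) = ∑ ℓ : Fin s, M⁻¹ i ℓ • ∑ j : Fin s, M ℓ j • v (κ j) := by
      simp only [smul_sum, smul_smul]
      rw [sum_comm]
      simp only [← sum_smul, ← Matrix.mul_apply, Matrix.nonsing_inv_mul M (Ne.isUnit hM),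
        Matrix.one_apply]
      simp
    rw [this]
    refine S.sum_mem fun ℓ _ => S.smul_mem _ (Submodule.subset_span ⟨Fin.castLE hsr ℓ, ?_⟩)
    simp only [Fin.val_castLE]
    rw [hval]
    rfl
  intro k hk
  rw [ha0 k hk]
  refine S.sum_mem fun j hj => S.smul_mem _ ?_
  have : j ∈ Set.range κ := by rw [hκ, range_orderEmbOfFin]; exact hj
  obtain ⟨i, rfl⟩ := this
  exact hpivot i

end Condenser

/-! ### Products of two polynomial matrices -/

section PolyMatrix

open Polynomial

variable {K : Type*} [Field K] {w : ℕ}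

/-- The value of a polynomial matrix at a point. -/
noncomputable def matEval (x : K) : Matrix (Fin w) (Fin w) K[X] →+* Matrix (Fin w) (Fin w) K :=
  (evalRingHom x).mapMatrix

theorem matEval_apply (x : K) (A : Matrix (Fin w) (Fin w) K[X]) (i j : Fin w) :
    matEval x A i j = (A i j).eval x := rfl

theorem matEval_eq_sum {A : Matrix (Fin w) (Fin w) K[X]} {T : ℕ}
    (hA : ∀ i j, (A i j).natDegree < T) (x : K) :
    matEval x A = ∑ k ∈ Finset.range T, x ^ k • A.map (fun p => p.coeff k) := by
  ext i j
  simp only [matEval_apply, Matrix.sum_apply, Matrix.smul_apply, Matrix.map_apply, smul_eq_mul]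
  rw [eval_eq_sum_range' (hA i j)]
  exact Finset.sum_congr rfl fun k _ => mul_comm _ _

/-- Base-`k` digits are unique: no cancellation occurs in `p(z) q(z ^ k)` when `deg p < k`. -/
theorem coeff_mul_expand {p q : K[X]} {k i : ℕ} (hp : p.natDegree < k) (hi : i < k) (j : ℕ) :
    (p * expand K k q).coeff (i + k * j) = p.coeff i * q.coeff j := by
  have hk : 0 < k := by omega
  rw [coeff_mul, Finset.sum_eq_single (i, k * j)]
  · simp [coeff_expand hk, hk]
  · rintro ⟨a, b⟩ hab hne
    rw [Finset.HasAntidiagonal.mem_antidiagonal] at hab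
    rw [coeff_expand hk]
    split_ifs with hb
    · obtain ⟨b, rfl⟩ := hb
      simp only at hab
      by_cases ha : a < k
      · exfalso
        have h1 : a = i := by
          have := congrArg (· % k) hab
          simpa [Nat.add_mul_mod_self_left, Nat.mod_eq_of_lt, ha, hi] using this
        subst h1
        have h2 : k * b = k * j := by omega
        exact hne (by rw [h2])
      · rw [coeff_eq_zero_of_natDegree_lt (by omega), zero_mul]
    · simp
  · intro h
    simp at h

/-- The univariate polynomial matrix `A(z) B(z ^ k)`. -/
noncomputable def kroneckerMul (k : ℕ) (A B : Matrix (Fin w) (Fin w) K[X]) :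
    Matrix (Fin w) (Fin w) K[X] :=
  A * (expand K k).mapMatrix B

theorem matEval_kroneckerMul (k : ℕ) (A B : Matrix (Fin w) (Fin w) K[X]) (x : K) :
    matEval x (kroneckerMul k A B) = matEval x A * matEval (x ^ k) B := by
  rw [kroneckerMul, map_mul]
  congr 1
  ext i j
  simp [matEval_apply, expand_eval]

theorem natDegree_kroneckerMul_le {k a : ℕ} {A B : Matrix (Fin w) (Fin w) K[X]}
    (hA : ∀ i j, (A i j).natDegree ≤ a) (hB : ∀ i j, (B i j).natDegree ≤ a) (i j : Fin w) :
    (kroneckerMul k A B i j).natDegree ≤ a + a * k := by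
  rw [kroneckerMul, Matrix.mul_apply]
  refine natDegree_sum_le_of_forall_le _ _ fun m _ => natDegree_mul_le.trans ?_
  refine Nat.add_le_add (hA i m) ?_
  simp only [AlgHom.mapMatrix_apply, Matrix.map_apply, natDegree_expand]
  exact Nat.mul_le_mul_right _ (hB m j)

/-- The coefficients of `A(z) B(z ^ k)` span all products `A(x) B(y)`. Either the degree of `A` is
below `k`, so that the coefficients of `A(x) B(y)` are recovered as base-`k` digits, or the
matrices are `1 × 1`, where it suffices that `A(z) B(z ^ k)` is nonzero. -/
theorem mul_mem_span_coeff_kroneckerMul {k T : ℕ} (hk : 0 < k) {A B : Matrix (Fin w) (Fin w) K[X]}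
    (hT : ∀ i j, (kroneckerMul k A B i j).natDegree < T)
    (h : (∀ i j, (A i j).natDegree < k) ∨ w = 1) (x y : K) :
    matEval x A * matEval y B ∈ Submodule.span K
      ((fun l => (kroneckerMul k A B).map (fun p => p.coeff l)) '' Set.Iio T) := by
  set S := Submodule.span K
      ((fun l => (kroneckerMul k A B).map (fun p => p.coeff l)) '' Set.Iio T) with hS
  have hmem : ∀ l, (kroneckerMul k A B).map (fun p => p.coeff l) ∈ S := by
    intro l
    by_cases hl : l < T
    · exact Submodule.subset_span ⟨l, hl, rfl⟩
    · convert S.zero_mem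
      ext i j
      exact coeff_eq_zero_of_natDegree_lt ((hT i j).trans_le (not_lt.1 hl))
  rcases h with h | rfl
  · have hprod : ∀ a < k, ∀ b, A.map (fun p => p.coeff a) * B.map (fun p => p.coeff b) ∈ S := by
      intro a ha b
      convert hmem (a + k * b) using 1
      ext i j
      simp only [kroneckerMul, Matrix.mul_apply, Matrix.map_apply, finsetSum_coeff,
        AlgHom.mapMatrix_apply]
      exact Finset.sum_congr rfl fun m _ => (coeff_mul_expand (h i m) ha b).symm
    obtain ⟨t, ht⟩ : ∃ t, ∀ i j, (B i j).natDegree < t := by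
      refine ⟨(∑ i, ∑ j, (B i j).natDegree) + 1, fun i j => Nat.lt_succ_of_le ?_⟩
      exact (Finset.single_le_sum (f := fun j => (B i j).natDegree) (fun _ _ => Nat.zero_le _)
        (Finset.mem_univ j)).trans
        (Finset.single_le_sum (f := fun i => ∑ j, (B i j).natDegree) (fun _ _ => Nat.zero_le _)
        (Finset.mem_univ i))
    rw [matEval_eq_sum h, matEval_eq_sum ht, Finset.sum_mul]
    refine S.sum_mem fun a ha => ?_
    rw [Finset.mul_sum]
    refine S.sum_mem fun b _ => ?_
    rw [smul_mul_smul_comm]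
    exact S.smul_mem _ (hprod a (Finset.mem_range.1 ha) b)
  · by_cases h0 : A 0 0 * expand K k (B 0 0) = 0
    · have : matEval x A * matEval y B = 0 := by
        ext i j
        rw [Subsingleton.elim i 0, Subsingleton.elim j 0]
        rcases mul_eq_zero.1 h0 with h0 | h0
        · simp [Matrix.mul_apply, matEval_apply, h0]
        · simp [Matrix.mul_apply, matEval_apply, (expand_eq_zero hk).1 h0]
      rw [this]
      exact S.zero_mem
    · obtain ⟨l, hl⟩ : ∃ l, (A 0 0 * expand K k (B 0 0)).coeff l ≠ 0 := by
        by_contra! hc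
        exact h0 (Polynomial.ext (by simpa using hc))
      convert S.smul_mem ((matEval x A * matEval y B) 0 0 *
        ((A 0 0 * expand K k (B 0 0)).coeff l)⁻¹) (hmem l) using 1
      ext i j
      rw [Subsingleton.elim i 0, Subsingleton.elim j 0]
      simp [kroneckerMul, Matrix.mul_apply (M := A), hl]

/-- For all but finitely many `α`, every product `A(x) B(y)` lies in the span of the `w ^ 2`
matrices `A(ω ^ ℓ α) B((ω ^ ℓ α) ^ k)`. -/
theorem finite_not_mul_mem_span {k a : ℕ} (hk : 0 < k) {ω : K} (hω0 : ω ≠ 0)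
    (hω : Set.InjOn (fun m : ℕ => ω ^ m) (Set.Iio (a + a * k + 1)))
    {A B : Matrix (Fin w) (Fin w) K[X]}
    (hA : ∀ i j, (A i j).natDegree ≤ a) (hB : ∀ i j, (B i j).natDegree ≤ a)
    (h : a < k ∨ w = 1) :
    {α : K | ¬ ∀ x y, matEval x A * matEval y B ∈ Submodule.span K
      (Set.range fun ℓ : Fin (w ^ 2) => matEval (ω ^ ((ℓ : ℕ) + 1) * α) A *
        matEval ((ω ^ ((ℓ : ℕ) + 1) * α) ^ k) B)}.Finite := by
  have hT : ∀ i j, (kroneckerMul k A B i j).natDegree < a + a * k + 1 :=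
    fun i j => Nat.lt_succ_of_le (natDegree_kroneckerMul_le hA hB i j)
  refine (finite_not_span_values (V := Matrix (Fin w) (Fin w) K) (r := w ^ 2)
    (by simp [Module.finrank_matrix, sq]) hω0 hω
    (fun l => (kroneckerMul k A B).map (fun p => p.coeff l))).subset ?_
  intro α hα hspan
  refine hα fun x y => ?_
  have := mul_mem_span_coeff_kroneckerMul hk hT
    (h.imp_left fun h i j => (hA i j).trans_lt h) x y
  refine Submodule.span_le.2 ?_ this
  rintro _ ⟨l, hl, rfl⟩
  simp only [← matEval_kroneckerMul, matEval_eq_sum hT]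
  exact hspan l hl

end PolyMatrix

/-! ### The interpolation curves and the merging of blocks -/

/-- The ordered product of a family indexed by `{0,1}^i`, in the order of the binary
representations, with the last bit most significant. -/
def blockProd {M : Type*} [Monoid M] : ∀ {i : ℕ}, ((Fin i → Fin 2) → M) → M
  | 0, f => f Fin.elim0
  | _ + 1, f => blockProd (fun b => f (Fin.snoc (α := fun _ => Fin 2) b 0)) *
      blockProd (fun b => f (Fin.snoc (α := fun _ => Fin 2) b 1))

theorem map_blockProd {M N : Type*} [Monoid M] [Monoid N] (φ : M →* N) :
    ∀ {i : ℕ} (f : (Fin i → Fin 2) → M), φ (blockProd f) = blockProd (fun b => φ (f b))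
  | 0, _ => rfl
  | _ + 1, f => by simp only [blockProd, map_mul, map_blockProd φ]

section Curve

open Polynomial

theorem natDegree_blockProd_le {K : Type*} [Field K] {w a : ℕ} : ∀ {i : ℕ}
    (f : (Fin i → Fin 2) → Matrix (Fin w) (Fin w) K[X]),
    (∀ b s t, (f b s t).natDegree ≤ a) → ∀ s t, (blockProd f s t).natDegree ≤ 2 ^ i * a
  | 0, f, hf, s, t => by simpa [blockProd] using hf _ s t
  | i + 1, f, hf, s, t => by
    rw [blockProd, Matrix.mul_apply]
    refine natDegree_sum_le_of_forall_le _ _ fun m _ => natDegree_mul_le.trans ?_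
    have h0 := natDegree_blockProd_le (fun b => f (Fin.snoc (α := fun _ => Fin 2) b 0))
      (fun b => hf _) s m
    have h1 := natDegree_blockProd_le (fun b => f (Fin.snoc (α := fun _ => Fin 2) b 1))
      (fun b => hf _) m t
    calc _ ≤ 2 ^ i * a + 2 ^ i * a := Nat.add_le_add h0 h1
      _ = 2 ^ (i + 1) * a := by ring

variable {K : Type*} [Field K] (w d : ℕ) (ω : K) (β : Fin (w ^ 2) → K)

/-- The argument of the `k`-th factor of the generator at the value `a` of the `k`-th seed
variable: `ω ^ ℓ a` for the bit `0`, and its `2 ^ k d w ^ 2`-th power for the bit `1`; here `ℓ` is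
counted from `1`. -/
def node (k : ℕ) (c : Fin 2) (ℓ : Fin (w ^ 2)) (a : K) : K :=
  if c = 0 then ω ^ ((ℓ : ℕ) + 1) * a else (ω ^ ((ℓ : ℕ) + 1) * a) ^ (2 ^ k * d * w ^ 2)

/-- The output of the generator on `i` bits as a univariate polynomial in its last seed variable,
the other seed variables having the values `α`. -/
noncomputable def curve {i : ℕ} (b : Fin i → Fin 2) (α : Fin i → K) : K[X] :=
  ∑ ℓ : Fin i → Fin (w ^ 2),
    C (∏ k : Fin i, (interp w β ℓ k.castSucc).eval (node w d ω k (b k) (ℓ k) (α k))) *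
      interp w β ℓ (Fin.last i)

theorem curve_zero (b : Fin 0 → Fin 2) (α : Fin 0 → K) : curve w d ω β b α = X := by
  simp [curve, interp]

theorem interp_snoc_castSucc {i : ℕ} (ℓ : Fin i → Fin (w ^ 2)) (m : Fin (w ^ 2))
    (k : Fin (i + 1)) :
    interp w β (Fin.snoc (α := fun _ => Fin (w ^ 2)) ℓ m) k.castSucc = interp w β ℓ k := by
  refine Fin.cases ?_ (fun j => ?_) k
  · simp [interp]
  · rw [← Fin.succ_castSucc]
    simp [interp]

theorem interp_last_succ {i : ℕ} (ℓ : Fin (i + 1) → Fin (w ^ 2)) :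
    interp w β ℓ (Fin.last (i + 1)) = Lagrange.basis Finset.univ β (ℓ (Fin.last i)) := by
  rw [← Fin.succ_last]
  simp [interp]

/-- The curve on `i + 1` bits interpolates, over the nodes `β`, the values of the curve on the
first `i` bits at the points prescribed by the last bit. -/
theorem eval_curve_snoc {β : Fin (w ^ 2) → K} (hβ : Function.Injective β) {i : ℕ}
    (b : Fin i → Fin 2) (c : Fin 2) (α : Fin i → K) (a : K) (m : Fin (w ^ 2)) :
    (curve w d ω β (Fin.snoc (α := fun _ => Fin 2) b c)
      (Fin.snoc (α := fun _ => K) α a)).eval (β m) =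
      (curve w d ω β b α).eval (node w d ω i c m a) := by
  have hbasis : ∀ t : Fin (w ^ 2),
      (Lagrange.basis Finset.univ β t).eval (β m) = if t = m then 1 else 0 := by
    intro t
    split_ifs with h
    · rw [h, Lagrange.eval_basis_self hβ.injOn (Finset.mem_univ _)]
    · rw [Lagrange.eval_basis_of_ne h (Finset.mem_univ _)]
  simp only [curve, eval_finsetSum]
  rw [← (Fin.snocEquiv fun _ => Fin (w ^ 2)).sum_comp, Fintype.sum_prod_type]
  rw [Finset.sum_eq_single m]
  · refine Finset.sum_congr rfl fun ℓ _ => ?_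
    simp only [Fin.snocEquiv, Equiv.coe_fn_mk, eval_mul, eval_C]
    rw [Fin.prod_univ_castSucc, interp_last_succ, hbasis]
    simp only [if_true, mul_one, interp_snoc_castSucc, Fin.snoc_castSucc, Fin.snoc_last,
      Fin.val_castSucc,
      Fin.val_last]
  · intro t _ ht
    refine Finset.sum_eq_zero fun ℓ _ => ?_
    simp only [Fin.snocEquiv, Equiv.coe_fn_mk, eval_mul, eval_C]
    rw [interp_last_succ, Fin.snoc_last, hbasis, if_neg ht, mul_zero]
  · simp

theorem natDegree_interp_le {i : ℕ} (hβ : Function.Injective β)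
    (ℓ : Fin i → Fin (w ^ 2)) (k : Fin (i + 1)) :
    (interp w β ℓ k).natDegree ≤ if k = 0 then 1 else w ^ 2 - 1 := by
  refine Fin.cases ?_ (fun j => ?_) k
  · simp [interp]
  · simp only [interp, Fin.cons_succ, Fin.succ_ne_zero, if_false]
    rw [Lagrange.natDegree_basis hβ.injOn (Finset.mem_univ _)]
    simp

theorem natDegree_curve_le (hβ : Function.Injective β) {i : ℕ} (b : Fin i → Fin 2)
    (α : Fin i → K) : (curve w d ω β b α).natDegree ≤ if i = 0 then 1 else w ^ 2 - 1 := by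
  refine natDegree_sum_le_of_forall_le _ _ fun ℓ (_ : ℓ ∈ Finset.univ) =>
    (natDegree_C_mul_le _ _).trans ?_
  refine (natDegree_interp_le w β hβ ℓ (Fin.last i)).trans (le_of_eq ?_)
  simp [Fin.ext_iff]

/-- The matrix polynomial obtained from a block by substituting the curves has degree below
`2 ^ i d w ^ 2`, the exponent used at the next merging step, except that equality may occur when
`w = 1`. -/
theorem blockDegree_bounds {i e : ℕ} (hd : 0 < d) (hw : 0 < w)
    (he : e ≤ if i = 0 then 1 else w ^ 2 - 1) :
    2 ^ i * (d * e) ≤ 2 ^ i * d * w ^ 2 ∧ (2 ^ i * (d * e) < 2 ^ i * d * w ^ 2 ∨ w = 1) := by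
  have hpos : 0 < 2 ^ i * d := by positivity
  have hw2 : 1 ≤ w ^ 2 := Nat.one_le_pow _ _ hw
  rw [← mul_assoc]
  have hle : e ≤ w ^ 2 := he.trans (by split_ifs <;> omega)
  refine ⟨Nat.mul_le_mul_left _ hle, ?_⟩
  rcases Nat.lt_or_ge 1 w with h | h
  · refine Or.inl (Nat.mul_lt_mul_of_pos_left ?_ hpos)
    have : 1 < w ^ 2 := Nat.one_lt_pow two_ne_zero h
    refine he.trans_lt ?_
    split_ifs <;> omega
  · exact Or.inr (by omega)

variable {w d ω β}

/-- Over an infinite field the first `i` seed variables can be fixed, simultaneously for a finite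
family of blocks of `2 ^ i` matrix polynomials of degree at most `d`, so that the product of any
values of the matrices of a block lies in the span of the products obtained by substituting the
interpolation curves. -/
theorem exists_blockProd_mem_span [Infinite K] (hd : 0 < d) (hw : 0 < w) (hω0 : ω ≠ 0)
    (hβ : Function.Injective β) (i : ℕ) :
    ∀ (ι : Type) [Finite ι]
      (_ : Set.InjOn (fun m : ℕ => ω ^ m) (Set.Iio ((2 ^ i * d * w ^ 2) ^ 2)))
      (M : ι → (Fin i → Fin 2) → Matrix (Fin w) (Fin w) K[X])
      (_ : ∀ c b s t, (M c b s t).natDegree ≤ d),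
      ∃ α : Fin i → K, ∀ c (x : (Fin i → Fin 2) → K),
        blockProd (fun b => matEval (x b) (M c b)) ∈ Submodule.span K
          (Set.range fun u : K =>
            blockProd (fun b => matEval ((curve w d ω β b α).eval u) (M c b))) := by
  induction i with
  | zero =>
    intro ι _ _ M _
    refine ⟨Fin.elim0, fun c x => Submodule.subset_span ⟨x Fin.elim0, ?_⟩⟩
    simp [blockProd, curve_zero]
  | succ i ih =>
    intro ι _ hω M hM
    -- The order of `ω` exceeds the degree of `A(z) B(z ^ k)`, where `k = 2 ^ i d w ^ 2`.
    have hT : (2 ^ i * d * w ^ 2) + (2 ^ i * d * w ^ 2) * (2 ^ i * d * w ^ 2) + 1 ≤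
        (2 ^ (i + 1) * d * w ^ 2) ^ 2 := by
      have : 0 < 2 ^ i * d * w ^ 2 := by positivity
      have h2 : 2 ^ (i + 1) * d * w ^ 2 = 2 * (2 ^ i * d * w ^ 2) := by ring
      rw [h2]
      nlinarith
    obtain ⟨α, hα⟩ := ih (ι × Fin 2)
      (hω.mono (Set.Iio_subset_Iio (le_trans (by rw [sq]; omega) hT)))
      (fun c b => M c.1 (Fin.snoc (α := fun _ => Fin 2) b c.2)) (fun c b => hM _ _)
    -- the matrix polynomials of the half-blocks along the curves
    let B : ι → Fin 2 → Matrix (Fin w) (Fin w) K[X] := fun c t => blockProd fun b =>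
      (compRingHom (curve w d ω β b α)).mapMatrix (M c (Fin.snoc (α := fun _ => Fin 2) b t))
    have hBeval : ∀ c t u, matEval u (B c t) = blockProd fun b =>
        matEval ((curve w d ω β b α).eval u) (M c (Fin.snoc (α := fun _ => Fin 2) b t)) := by
      intro c t u
      simp only [B]
      rw [← MonoidHom.coe_coe, map_blockProd]
      congr 1
      ext b p q
      simp [matEval_apply, eval_comp]
    set e := if i = 0 then 1 else w ^ 2 - 1 with he
    have hBdeg : ∀ c t p q, (B c t p q).natDegree ≤ 2 ^ i * (d * e) := by
      intro c t p q
      refine natDegree_blockProd_le _ (fun b s t => ?_) p q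
      simp only [RingHom.mapMatrix_apply, Matrix.map_apply, coe_compRingHom_apply]
      exact natDegree_comp_le.trans
        (Nat.mul_le_mul (hM _ _ _ _) (natDegree_curve_le w d ω β hβ b α))
    obtain ⟨hle, hlt⟩ := blockDegree_bounds w d (i := i) hd hw he.le
    have hfin : (⋃ c : ι, {a : K | ¬ ∀ x y, matEval x (B c 0) * matEval y (B c 1) ∈
        Submodule.span K (Set.range fun ℓ : Fin (w ^ 2) =>
          matEval (ω ^ ((ℓ : ℕ) + 1) * a) (B c 0) *
          matEval ((ω ^ ((ℓ : ℕ) + 1) * a) ^ (2 ^ i * d * w ^ 2)) (B c 1))}).Finite := by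
      refine Set.finite_iUnion fun c => finite_not_mul_mem_span (by positivity) hω0
        (hω.mono (Set.Iio_subset_Iio (le_trans ?_ hT))) (hBdeg c 0) (hBdeg c 1) hlt
      gcongr
    -- One value of the new seed variable is good for all blocks.
    obtain ⟨a, ha⟩ := hfin.infinite_compl.nonempty
    simp only [Set.mem_compl_iff, Set.mem_iUnion, Set.mem_ofPred_eq, not_exists, not_not] at ha
    refine ⟨Fin.snoc (α := fun _ => K) α a, fun c x => ?_⟩
    set S := Submodule.span K (Set.range fun u : K => blockProd (fun b =>
      matEval ((curve w d ω β b (Fin.snoc (α := fun _ => K) α a)).eval u) (M c b))) with hS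
    have hmem : ∀ u v, matEval u (B c 0) * matEval v (B c 1) ∈ S := by
      intro u v
      refine Submodule.span_le.2 ?_ (ha c u v)
      rintro _ ⟨ℓ, rfl⟩
      refine Submodule.subset_span ⟨β ℓ, ?_⟩
      simp only [blockProd, eval_curve_snoc w d ω hβ, hBeval, node]
      simp
    rw [blockProd]
    have h0 := hα (c, 0) (fun b => x (Fin.snoc (α := fun _ => Fin 2) b 0))
    have h1 := hα (c, 1) (fun b => x (Fin.snoc (α := fun _ => Fin 2) b 1))
    have h01 := Submodule.mul_mem_mul h0 h1
    rw [Submodule.span_mul_span] at h01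
    refine Submodule.span_le.2 ?_ h01
    rintro _ ⟨_, ⟨u, rfl⟩, _, ⟨v, rfl⟩, rfl⟩
    simp only [← hBeval]
    exact hmem u v

end Curve

/-! ### Branching programs as products of matrices -/

section Programs

open Polynomial

/-- The entries of a product of matrices are sums over paths. -/
theorem listProd_ofFn_apply {R ι : Type*} [CommSemiring R] [Fintype ι] [DecidableEq ι] {m : ℕ}
    (Φ : Fin m → Matrix ι ι R) (s t : ι) :
    (List.ofFn Φ).prod s t = ∑ v : Fin (m + 1) → ι,
      if v 0 = s ∧ v (Fin.last m) = t then ∏ i, Φ i (v i.castSucc) (v i.succ) else 0 := by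
  induction m generalizing s with
  | zero =>
    rw [← (Equiv.funUnique (Fin 1) ι).symm.sum_comp]
    simp [Matrix.one_apply, ite_and]
  | succ m ih =>
    rw [List.ofFn_succ, List.prod_cons, Matrix.mul_apply,
      ← (Fin.consEquiv fun _ => ι).sum_comp, Fintype.sum_prod_type]
    symm
    rw [Finset.sum_eq_single s]
    · symm
      simp only [ih, Finset.mul_sum]
      rw [Finset.sum_comm]
      refine Finset.sum_congr rfl fun v _ => ?_
      rw [Finset.sum_eq_single (v 0)]
      · simp only [Fin.consEquiv, Equiv.coe_fn_mk, Fin.cons_zero, true_and, ← Fin.succ_last,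
          Fin.cons_succ, Fin.prod_univ_succ, Fin.castSucc_zero, ← Fin.succ_castSucc, mul_ite,
          mul_zero]
      · intro j _ hj
        simp [hj.symm]
      · simp
    · intro a _ ha
      simp [Fin.consEquiv, ha]
    · simp

/-- Vertices `Fin (size i)` of layers of size at most `w` are identified with elements of
`Fin w`. -/
theorem sum_castLE {R ι : Type*} [AddCommMonoid R] [Fintype ι] [DecidableEq ι] {w : ℕ}
    {size : ι → ℕ} (hs : ∀ i, size i ≤ w) (g : (ι → Fin w) → R) :
    ∑ v : (∀ i, Fin (size i)), g (fun i => Fin.castLE (hs i) (v i)) =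
      ∑ v : ι → Fin w, if ∀ i, (v i : ℕ) < size i then g v else 0 := by
  rw [← Finset.sum_filter]
  refine Finset.sum_bij (fun v _ i => Fin.castLE (hs i) (v i)) ?_ ?_ ?_ ?_
  · intro v _
    simp
  · intro v _ v' _ h
    funext i
    exact Fin.castLE_injective (hs i) (congrFun h i)
  · intro v hv
    exact ⟨fun i => ⟨v i, (Finset.mem_filter.1 hv).2 i⟩, Finset.mem_univ _, rfl⟩
  · intro v _
    rfl

variable {F : Type*} [Field F] {m : ℕ} {V : Type*}

/-- The edge labels of a layer of a branching program of width at most `w`, as a `w × w` matrix;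
missing vertices contribute zero entries. -/
noncomputable def ROABP.layerMatrix (B : ROABP F m) (w : ℕ) (i : Fin m) :
    Matrix (Fin w) (Fin w) F[X] :=
  Matrix.of fun u v => if h : (u : ℕ) < B.size i.castSucc ∧ (v : ℕ) < B.size i.succ then
    B.label i ⟨u, h.1⟩ ⟨v, h.2⟩ else 0

theorem ROABP.natDegree_layerMatrix_le {B : ROABP F m} {d : ℕ}
    (hd : ∀ i u v, (B.label i u v).natDegree ≤ d) (w : ℕ) (i : Fin m) (u v : Fin w) :
    (B.layerMatrix w i u v).natDegree ≤ d := by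
  rw [ROABP.layerMatrix, Matrix.of_apply]
  split_ifs
  · exact hd _ _ _
  · simp

theorem ROABP.poly_eq_listProd (B : ROABP F m) {w : ℕ} (hw : 0 < w) (hB : ∀ i, B.size i ≤ w)
    (ord : Fin m ≃ V) :
    B.poly ord = (List.ofFn fun i => (B.layerMatrix w i).map
      (Polynomial.aeval (MvPolynomial.X (ord i) : MvPolynomial V F))).prod ⟨0, hw⟩ ⟨0, hw⟩ := by
  rw [listProd_ofFn_apply, ROABP.poly]
  have key := sum_castLE hB fun v => ∏ i : Fin m,
    Polynomial.aeval (MvPolynomial.X (ord i) : MvPolynomial V F)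
      (B.layerMatrix w i (v i.castSucc) (v i.succ))
  refine Eq.trans ?_ (key.trans ?_)
  · simp [ROABP.layerMatrix]
  · refine Finset.sum_congr rfl fun v _ => ?_
    by_cases hv : ∀ i, (v i : ℕ) < B.size i
    · have h0 := hv 0
      have h1 := hv (Fin.last m)
      rw [B.size_source, Nat.lt_one_iff] at h0
      rw [B.size_sink, Nat.lt_one_iff] at h1
      rw [if_pos hv, if_pos ⟨Fin.ext h0, Fin.ext h1⟩]
      rfl
    · rw [if_neg hv]
      split_ifs with h
      · push Not at hv
        obtain ⟨i, hi⟩ := hv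
        symm
        induction i using Fin.lastCases with
        | last => simp [h.2, B.size_sink] at hi
        | cast i =>
          refine Finset.prod_eq_zero (Finset.mem_univ i) ?_
          simp [ROABP.layerMatrix, hi.not_gt]
      · rfl

/-- Conversely, the corner entry of a product of `r × r` matrices of univariate polynomials is
computed by a branching program of width at most `r`. -/
theorem listProd_mem_roABPClass {r d : ℕ} (hr : 0 < r) (ord : Fin m ≃ V)
    (Φ : Fin m → Matrix (Fin r) (Fin r) F[X]) (hΦ : ∀ i u v, (Φ i u v).natDegree ≤ d) :
    (List.ofFn fun i => (Φ i).map
      (Polynomial.aeval (MvPolynomial.X (ord i) : MvPolynomial V F))).prod ⟨0, hr⟩ ⟨0, hr⟩ ∈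
      roABPClass F r d ord := by
  have hs : ∀ i : Fin (m + 1), (if i = 0 ∨ i = Fin.last m then 1 else r) ≤ r := by
    intro i
    split_ifs <;> omega
  refine ⟨⟨fun i => if i = 0 ∨ i = Fin.last m then 1 else r, by simp, by simp,
    fun i u v => Φ i (Fin.castLE (hs _) u) (Fin.castLE (hs _) v)⟩, hs, fun i u v => hΦ _ _ _, ?_⟩
  rw [listProd_ofFn_apply, ROABP.poly]
  refine (sum_castLE hs fun v => ∏ i : Fin m,
    Polynomial.aeval (MvPolynomial.X (ord i) : MvPolynomial V F)
      (Φ i (v i.castSucc) (v i.succ))).trans ?_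
  refine Finset.sum_congr rfl fun v _ => ?_
  have : (∀ i, (v i : ℕ) < if i = 0 ∨ i = Fin.last m then 1 else r) ↔
      v 0 = ⟨0, hr⟩ ∧ v (Fin.last m) = ⟨0, hr⟩ := by
    constructor
    · intro h
      have h0 := h 0
      have h1 := h (Fin.last m)
      simp only [true_or, or_true, if_true, Nat.lt_one_iff] at h0 h1
      exact ⟨Fin.ext h0, Fin.ext h1⟩
    · rintro ⟨h0, h1⟩ i
      split_ifs with h
      · rcases h with rfl | rfl <;> simp [h0, h1]
      · exact (v i).2
  simp only [this]
  rfl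

/-- The sink of a branching program can absorb a vector of constants. -/
theorem listProd_mulVec_mem_roABPClass {r d k : ℕ} (hr : 0 < r) (ord : Fin (k + 1) ≃ V)
    (Φ : Fin (k + 1) → Matrix (Fin r) (Fin r) F[X]) (hΦ : ∀ i u v, (Φ i u v).natDegree ≤ d)
    (c : Fin r → F) :
    ∑ t, (List.ofFn fun i => (Φ i).map
      (Polynomial.aeval (MvPolynomial.X (ord i) : MvPolynomial V F))).prod ⟨0, hr⟩ t *
        MvPolynomial.C (c t) ∈ roABPClass F r d ord := by
  let N : Matrix (Fin r) (Fin r) F[X] := Matrix.of fun t _ => C (c t)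
  let Ψ : Fin (k + 1) → Matrix (Fin r) (Fin r) F[X] :=
    Fin.snoc (α := fun _ => Matrix (Fin r) (Fin r) F[X]) (Fin.init Φ) (Φ (Fin.last k) * N)
  convert listProd_mem_roABPClass (d := d) hr ord Ψ ?_ using 1
  · have h1 : ∀ i : Fin k, Ψ i.castSucc = Φ i.castSucc := fun i => by simp [Ψ, Fin.init]
    have h2 : Ψ (Fin.last k) = Φ (Fin.last k) * N := by simp [Ψ]
    rw [List.ofFn_succ', List.ofFn_succ', List.concat_eq_append, List.concat_eq_append,
      List.prod_append, List.prod_append, List.prod_singleton, List.prod_singleton, h2]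
    simp only [h1]
    rw [← AlgHom.mapMatrix_apply (f := Polynomial.aeval (MvPolynomial.X (ord (Fin.last k))))
      (M := Φ (Fin.last k) * N), map_mul, ← mul_assoc]
    conv_rhs => rw [Matrix.mul_apply]
    refine Finset.sum_congr rfl fun t _ => ?_
    simp [N, MvPolynomial.algebraMap_eq]
  · intro i u v
    induction i using Fin.lastCases with
    | last =>
      simp only [Ψ, Fin.snoc_last, Matrix.mul_apply, N, Matrix.of_apply]
      exact natDegree_sum_le_of_forall_le _ _ fun j _ => (natDegree_mul_C_le _ _).trans (hΦ _ _ _)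
    | cast i => simpa [Ψ, Fin.init] using hΦ _ _ _

theorem degreeOf_aeval_le {R σ : Type*} [CommSemiring R] (j : σ) (q : MvPolynomial σ R)
    (p : R[X]) :
    (Polynomial.aeval q p).degreeOf j ≤ p.natDegree * q.degreeOf j := by
  rw [aeval_eq_sum_range]
  refine (MvPolynomial.degreeOf_sum_le _ _ _).trans (Finset.sup_le fun k hk => ?_)
  rw [MvPolynomial.smul_eq_C_mul]
  refine (MvPolynomial.degreeOf_C_mul_le _ _ _).trans ?_
  refine (MvPolynomial.degreeOf_pow_le _ _ _).trans ?_
  exact Nat.mul_le_mul_right _ (Finset.mem_range_succ_iff.1 hk)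

/-- A branching program reads every variable once, so its degree in each variable is bounded by
the degree of its labels. -/
theorem degreeOf_le_of_mem_roABPClass {w d : ℕ} {ord : Fin m ≃ V} {P : MvPolynomial V F}
    (hP : P ∈ roABPClass F w d ord) (j : V) : P.degreeOf j ≤ d := by
  classical
  obtain ⟨B, -, hd, rfl⟩ := hP
  refine (MvPolynomial.degreeOf_sum_le _ _ _).trans (Finset.sup_le fun v _ => ?_)
  refine (MvPolynomial.degreeOf_prod_le _ _ _).trans ?_
  have hterm : ∀ i : Fin m, MvPolynomial.degreeOf j
      (Polynomial.aeval (MvPolynomial.X (ord i) : MvPolynomial V F)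
        (B.label i (v i.castSucc) (v i.succ))) ≤ if ord i = j then d else 0 := by
    intro i
    refine (degreeOf_aeval_le _ _ _).trans ?_
    have := hd i (v i.castSucc) (v i.succ)
    rw [MvPolynomial.degreeOf_X]
    simp only [eq_comm (a := j)]
    split_ifs <;> simp [this]
  refine (Finset.sum_le_sum fun i _ => hterm i).trans ?_
  rw [Finset.sum_eq_single (ord.symm j)]
  · simp
  · intro i _ hi
    rw [if_neg]
    rintro rfl
    simp at hi
  · simp

theorem mem_restrictDegree_of_mem_roABPClass {n w d : ℕ} {ord : Fin m ≃ Fin n}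
    {P : MvPolynomial (Fin n) F} (hP : P ∈ roABPClass F w d ord) :
    P ∈ MvPolynomial.restrictDegree (Fin n) F d := by
  rw [MvPolynomial.mem_restrictDegree]
  exact fun s hs i => MvPolynomial.degreeOf_le_iff.1 (degreeOf_le_of_mem_roABPClass hP i) s hs

theorem listProd_eq_blockProd {M : Type*} [Monoid M] {n : ℕ} (f : (Fin n → Fin 2) → M) :
    (List.ofFn fun k : Fin (2 ^ n) => f (finFunctionFinEquiv.symm k)).prod = blockProd f := by
  induction n with
  | zero =>
    simp [blockProd]
    congr 1
    exact Subsingleton.elim _ _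
  | succ n ih =>
    have h2 : 2 ^ (n + 1) = 2 ^ n + 2 ^ n := by ring
    rw [List.ofFn_congr h2, List.ofFn_add, List.prod_append, blockProd, ← ih, ← ih]
    congr 4
    · funext k
      congr 1
      rw [Equiv.symm_apply_eq]
      ext
      have := congrArg Fin.val (finFunctionFinEquiv.apply_symm_apply k)
      rw [finFunctionFinEquiv_apply] at this
      rw [finFunctionFinEquiv_apply, Fin.sum_univ_castSucc]
      simp only [Fin.snoc_castSucc, Fin.snoc_last, Fin.val_castSucc, this]
      simp
    · funext k
      congr 1
      rw [Equiv.symm_apply_eq]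
      ext
      have := congrArg Fin.val (finFunctionFinEquiv.apply_symm_apply k)
      rw [finFunctionFinEquiv_apply] at this
      rw [finFunctionFinEquiv_apply, Fin.sum_univ_castSucc]
      simp only [Fin.snoc_castSucc, Fin.snoc_last, Fin.val_castSucc, this]
      simp

end Programs

/-! ### The Forbes–Shpilka generator hits branching programs -/

section Generator

open Polynomial

variable {F : Type*} [Field F] {n w d : ℕ} {ω : F} {β : Fin (w ^ 2) → F}

theorem interp_map {L : Type*} [Field L] (φ : F →+* L) {i : ℕ} (ℓ : Fin i → Fin (w ^ 2))
    (k : Fin (i + 1)) :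
    interp w (fun m => φ (β m)) ℓ k = (interp w β ℓ k).map φ := by
  refine Fin.cases ?_ (fun j => ?_) k
  · simp [interp]
  · simp [interp, Lagrange.basis, Lagrange.basisDivisor, Polynomial.map_prod]

/-- The values of the generator over an extension field lie on the interpolation curves. -/
theorem aeval_genFS {L : Type*} [Field L] [Algebra F L] (b : Fin n → Fin 2) (α : Fin n → L)
    (u : L) :
    MvPolynomial.aeval (Fin.snoc (α := fun _ => L) α u) (genFS w d ω β b) =
      (curve w d (algebraMap F L ω) (fun m => algebraMap F L (β m)) b α).eval u := by
  set y : Fin (n + 1) → L := Fin.snoc (α := fun _ => L) α u with hy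
  have hpt : ∀ (ℓ : Fin n → Fin (w ^ 2)) i, MvPolynomial.aeval y (point w ω ℓ i) =
      algebraMap F L ω ^ ((ℓ i : ℕ) + 1) * α i := by
    intro ℓ i
    simp [point, hy]
  simp only [genFS, curve, map_sum, eval_finsetSum, map_mul, eval_mul, eval_C]
  refine Finset.sum_congr rfl fun ℓ _ => ?_
  congr 1
  · rw [map_prod]
    refine Finset.prod_congr rfl fun i _ => ?_
    rw [interp_map, eval_map_algebraMap]
    simp only [map_add, map_mul, map_sub, map_one, map_natCast, loTerm, hiTerm,
      ← Polynomial.aeval_algHom_apply, map_pow, hpt, node]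
    have hb : b i = 0 ∨ b i = 1 := by
      generalize b i = c
      fin_cases c <;> simp
    rcases hb with hb | hb <;> simp [hb]
  · rw [interp_map, eval_map_algebraMap, lastTerm, ← Polynomial.aeval_algHom_apply]
    simp [hy]

/-- The value of a branching program in the order `X_1, …, X_N` as an entry of a block product. -/
theorem aeval_poly_eq_blockProd {L : Type*} [Field L] [Algebra F L] (B : ROABP F (2 ^ n))
    (hw : 0 < w) (hB : ∀ i, B.size i ≤ w) (x : (Fin n → Fin 2) → L) :
    MvPolynomial.aeval x (B.poly (monomialOrder (Equiv.refl (Fin n)))) =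
      blockProd (fun b => matEval (x b)
        ((B.layerMatrix w (finFunctionFinEquiv b)).map (Polynomial.map (algebraMap F L))))
        ⟨0, hw⟩ ⟨0, hw⟩ := by
  rw [B.poly_eq_listProd hw hB, ← listProd_eq_blockProd]
  have h := map_list_prod (MvPolynomial.aeval (R := F) x).mapMatrix
    (List.ofFn fun i => (B.layerMatrix w i).map (Polynomial.aeval
      (MvPolynomial.X (monomialOrder (Equiv.refl (Fin n)) i) : MvPolynomial _ F)))
  refine (congrFun (congrFun h ⟨0, hw⟩) ⟨0, hw⟩).trans ?_
  rw [List.map_ofFn]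
  refine congrArg (fun l : List (Matrix (Fin w) (Fin w) L) => l.prod ⟨0, hw⟩ ⟨0, hw⟩)
    (congrArg List.ofFn (funext fun i => ?_))
  ext s t
  simp [matEval_apply, ← Polynomial.aeval_algHom_apply, monomialOrder]

theorem bind₁_genFS_ne_zero (hd : 0 < d) (hw : 0 < w) (hω0 : ω ≠ 0)
    (hω : Set.InjOn (fun m : ℕ => ω ^ m) (Set.Iio ((2 ^ n * d * w ^ 2) ^ 2)))
    (hβ : Function.Injective β) {P : MvPolynomial (Fin n → Fin 2) F}
    (hP : P ∈ roABPClass F w d (monomialOrder (Equiv.refl (Fin n)))) (hP0 : P ≠ 0) :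
    MvPolynomial.bind₁ (genFS w d ω β) P ≠ 0 := by
  obtain ⟨B, hB, hBd, rfl⟩ := hP
  set P := B.poly (monomialOrder (Equiv.refl (Fin n))) with hPdef
  -- Generic seeds are found over the algebraic closure, which is infinite.
  let L := AlgebraicClosure F
  have hinj : Function.Injective (algebraMap F L) := (algebraMap F L).injective
  obtain ⟨x, hx⟩ : ∃ x : (Fin n → Fin 2) → L, MvPolynomial.aeval x P ≠ 0 := by
    by_contra! h
    refine hP0 (MvPolynomial.map_injective _ hinj ?_)
    rw [map_zero]
    refine MvPolynomial.funext fun x => ?_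
    rw [MvPolynomial.eval_map, map_zero, ← h x]
    rfl
  obtain ⟨α, hα⟩ := exists_blockProd_mem_span (K := L) (ω := algebraMap F L ω)
    (β := fun m => algebraMap F L (β m)) hd hw (by simpa using hω0) (hinj.comp hβ) n Unit
    (fun a ha b hb hab => hω ha hb (hinj (by simpa using hab)))
    (fun _ b => (B.layerMatrix w (finFunctionFinEquiv b)).map (Polynomial.map (algebraMap F L)))
    (fun _ b s t => natDegree_map_le.trans (B.natDegree_layerMatrix_le hBd w _ s t))
  -- If the corner entry vanished along the curves, it would vanish on their span.
  obtain ⟨u, hu⟩ : ∃ u : L, MvPolynomial.aeval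
      (fun b => (curve w d (algebraMap F L ω) (fun m => algebraMap F L (β m)) b α).eval u) P
        ≠ 0 := by
    by_contra! h
    have hle : Submodule.span L (Set.range fun u : L => blockProd (fun b => matEval
        ((curve w d (algebraMap F L ω) (fun m => algebraMap F L (β m)) b α).eval u)
        ((B.layerMatrix w (finFunctionFinEquiv b)).map (Polynomial.map (algebraMap F L))))) ≤
        LinearMap.ker (Matrix.entryLinearMap L L (⟨0, hw⟩ : Fin w) (⟨0, hw⟩ : Fin w)) := by
      refine Submodule.span_le.2 ?_
      rintro _ ⟨u, rfl⟩
      have := h u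
      rw [hPdef, aeval_poly_eq_blockProd B hw hB] at this
      exact this
    refine hx ?_
    rw [hPdef, aeval_poly_eq_blockProd B hw hB]
    exact hle (hα () x)
  intro h0
  refine hu ?_
  have := congrArg (MvPolynomial.aeval (Fin.snoc (α := fun _ => L) α u)) h0
  rw [map_zero, MvPolynomial.aeval_bind₁] at this
  simpa only [aeval_genFS] using this

end Generator

/-! ### The polynomial `P^FS` -/

section PolyFS

open Polynomial

variable {F : Type*} [Field F] {n : ℕ} (w d : ℕ) (ω : F) (β : Fin (w ^ 2) → F)

theorem expo_injective : Function.Injective (expo (n := n)) := by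
  intro b c h
  funext i
  have := DFunLike.congr_fun h i
  exact Fin.ext (by simpa [expo] using this)

theorem coeffVec_ofCoeffVec {R : Type*} [CommSemiring R] (c : (Fin n → Fin 2) → R) :
    coeffVec (ofCoeffVec c) = c := by
  classical
  funext b
  simp [coeffVec, ofCoeffVec, MvPolynomial.coeff_sum, MvPolynomial.coeff_monomial,
    expo_injective.eq_iff]

theorem prod_monomial {R ι σ : Type*} [CommSemiring R] (s : Finset ι) (f : ι → σ →₀ ℕ)
    (a : ι → R) : ∏ i ∈ s, MvPolynomial.monomial (f i) (a i) =
      MvPolynomial.monomial (∑ i ∈ s, f i) (∏ i ∈ s, a i) := by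
  classical
  induction s using Finset.induction_on with
  | empty => simp
  | insert i s hi ih => simp [Finset.prod_insert hi, Finset.sum_insert hi, ih,
      MvPolynomial.monomial_mul]

theorem polyFS_eq_ofCoeffVec : polyFS w d ω β = ofCoeffVec (genFS (n := n) w d ω β) := by
  simp only [polyFS, ofCoeffVec, genFS, map_sum]
  rw [Finset.sum_comm]
  refine Finset.sum_congr rfl fun ℓ _ => ?_
  have h : ∀ i : Fin n, MvPolynomial.C (loTerm w ω β ℓ i) +
      MvPolynomial.X i * MvPolynomial.C (hiTerm w d ω β ℓ i) =
      ∑ c : Fin 2, (MvPolynomial.monomial (Finsupp.single i (c : ℕ))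
        ((1 - ((c : ℕ) : MvPolynomial (Fin (n + 1)) F)) * loTerm w ω β ℓ i +
        ((c : ℕ) : MvPolynomial (Fin (n + 1)) F) * hiTerm w d ω β ℓ i)) := by
    intro i
    rw [mul_comm, MvPolynomial.C_mul_X_eq_monomial]
    simp [Fin.sum_univ_two]
  simp only [h]
  rw [Finset.prod_univ_sum, Fintype.piFinset_univ, Finset.sum_mul]
  refine Finset.sum_congr rfl fun b _ => ?_
  rw [prod_monomial, mul_comm, MvPolynomial.C_mul_monomial, mul_comm]
  congr 2
  ext i
  simp [expo, Finsupp.finsetSum_apply, Finsupp.single_apply]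

theorem coeffVec_map_polyFS (α : Fin (n + 1) → F) (b : Fin n → Fin 2) :
    coeffVec (MvPolynomial.map (MvPolynomial.eval α) (polyFS w d ω β)) b =
      MvPolynomial.eval α (genFS w d ω β b) := by
  rw [coeffVec, MvPolynomial.coeff_map, polyFS_eq_ofCoeffVec]
  exact congrArg _ (congrFun (coeffVec_ofCoeffVec _) b)

/-- The label of the edge from `s` to `t` in the `i`-th layer of the branching program computing
`P^FS(x, α)`. -/
noncomputable def fsLayer (α : Fin (n + 1) → F) (i : Fin n) :
    Matrix (Fin (w ^ 2)) (Fin (w ^ 2)) F[X] :=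
  Matrix.of fun s t =>
    C ((if (i : ℕ) = 0 then X else Lagrange.basis Finset.univ β s).eval
      (node w d ω i 1 t (α i.castSucc))) * X +
    C ((if (i : ℕ) = 0 then X else Lagrange.basis Finset.univ β s).eval
      (node w d ω i 0 t (α i.castSucc)))

theorem eval_point (α : Fin (n + 1) → F) (ℓ : Fin n → Fin (w ^ 2)) (i : Fin n) :
    MvPolynomial.eval α (point w ω ℓ i) = ω ^ ((ℓ i : ℕ) + 1) * α i.castSucc := by
  simp [point]

theorem eval_aeval (α : Fin (n + 1) → F) (q : MvPolynomial (Fin (n + 1)) F) (p : F[X]) :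
    MvPolynomial.eval α (Polynomial.aeval q p) = p.eval (MvPolynomial.eval α q) := by
  rw [← MvPolynomial.coe_aeval_eq_eval, RingHom.coe_coe, ← Polynomial.aeval_algHom_apply,
    Polynomial.coe_aeval_eq_eval]

theorem eval_loTerm (α : Fin (n + 1) → F) (ℓ : Fin n → Fin (w ^ 2)) (i : Fin n) :
    MvPolynomial.eval α (loTerm w ω β ℓ i) =
      (interp w β ℓ i.castSucc).eval (node w d ω i 0 (ℓ i) (α i.castSucc)) := by
  rw [loTerm, eval_aeval, eval_point, node, if_pos rfl]

theorem eval_hiTerm (α : Fin (n + 1) → F) (ℓ : Fin n → Fin (w ^ 2)) (i : Fin n) :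
    MvPolynomial.eval α (hiTerm w d ω β ℓ i) =
      (interp w β ℓ i.castSucc).eval (node w d ω i 1 (ℓ i) (α i.castSucc)) := by
  rw [hiTerm, eval_aeval, map_pow, eval_point, node, if_neg (by simp)]

theorem eval_lastTerm (α : Fin (n + 1) → F) (ℓ : Fin n → Fin (w ^ 2)) :
    MvPolynomial.eval α (lastTerm w β ℓ) =
      (interp w β ℓ (Fin.last n)).eval (α (Fin.last n)) := by
  rw [lastTerm, eval_aeval, MvPolynomial.eval_X]

theorem interp_eq_ite {i : ℕ} (s : Fin (w ^ 2)) (ℓ : Fin i → Fin (w ^ 2)) (k : Fin (i + 1)) :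
    interp w β ℓ k = if (k : ℕ) = 0 then X else
      Lagrange.basis Finset.univ β (Fin.cons (α := fun _ => Fin (w ^ 2)) s ℓ k) := by
  refine Fin.cases ?_ (fun j => ?_) k
  · simp [interp]
  · simp [interp]

theorem map_polyFS_mem_roABPClass {w : ℕ} (β : Fin (w ^ 2) → F) (hn : 0 < n) (hw : 0 < w)
    (α : Fin (n + 1) → F) :
    MvPolynomial.map (MvPolynomial.eval α) (polyFS w d ω β) ∈
      roABPClass F (w ^ 2) 1 (Equiv.refl (Fin n)) := by
  obtain ⟨n, rfl⟩ := Nat.exists_eq_add_one.2 hn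
  have hr : 0 < w ^ 2 := by positivity
  convert listProd_mulVec_mem_roABPClass (d := 1) hr (Equiv.refl (Fin (n + 1)))
    (fsLayer w d ω β α) ?_
    (fun t => (Lagrange.basis Finset.univ β t).eval (α (Fin.last _))) using 1
  · simp only [listProd_ofFn_apply, Finset.sum_mul]
    rw [Finset.sum_comm, ← (Fin.consEquiv fun _ => Fin (w ^ 2)).sum_comp, Fintype.sum_prod_type]
    symm
    rw [Finset.sum_eq_single ⟨0, hr⟩]
    · symm
      rw [polyFS, map_sum]
      refine Finset.sum_congr rfl fun ℓ _ => ?_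
      set v : Fin (n + 1 + 1) → Fin (w ^ 2) :=
        Fin.cons (α := fun _ => Fin (w ^ 2)) ⟨0, hr⟩ ℓ with hv
      change _ = ∑ t, (if v 0 = ⟨0, hr⟩ ∧ v (Fin.last (n + 1)) = t then _ else 0) * _
      have hv0 : v 0 = ⟨0, hr⟩ := rfl
      rw [Finset.sum_eq_single (v (Fin.last (n + 1))), if_pos ⟨hv0, rfl⟩]
      · rw [map_mul, map_prod, MvPolynomial.map_C, eval_lastTerm, interp_eq_ite w β ⟨0, hr⟩]
        congr 1
        · refine Finset.prod_congr rfl fun i _ => ?_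
          simp only [map_add, map_mul, MvPolynomial.map_C, MvPolynomial.map_X, eval_loTerm w d,
            eval_hiTerm, interp_eq_ite w β ⟨0, hr⟩ ℓ, fsLayer, Matrix.map_apply, Matrix.of_apply,
            Polynomial.aeval_C, Polynomial.aeval_X, MvPolynomial.algebraMap_eq,
            Equiv.refl_apply, Fin.val_castSucc]
          exact (add_comm _ _).trans (congrArg (· + _) (mul_comm _ _))
      · intro t _ ht
        rw [if_neg fun h => ht h.2.symm, zero_mul]
      · simp
    · intro t _ ht
      refine Finset.sum_eq_zero fun ℓ _ => Finset.sum_eq_zero fun t' _ => ?_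
      rw [if_neg fun h => ht h.1, zero_mul]
    · simp
  · intro i u v
    exact natDegree_linear_le

end PolyFS

/-! ### Degrees of the generator and evaluation points -/

section Degrees

variable {F : Type*} [Field F] {n w d : ℕ} {ω : F} {β : Fin (w ^ 2) → F}

theorem degreeOf_bind₁_le {σ τ : Type*} [Fintype σ] {P : MvPolynomial σ F}
    {G : σ → MvPolynomial τ F} {j : τ} {a e : ℕ} (hP : ∀ b, P.degreeOf b ≤ a)
    (hG : ∀ b, (G b).degreeOf j ≤ e) :
    (MvPolynomial.bind₁ G P).degreeOf j ≤ Fintype.card σ * (a * e) := by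
  rw [MvPolynomial.bind₁, MvPolynomial.aeval_def, MvPolynomial.eval₂_eq']
  refine (MvPolynomial.degreeOf_sum_le _ _ _).trans (Finset.sup_le fun m hm => ?_)
  rw [MvPolynomial.algebraMap_eq]
  refine (MvPolynomial.degreeOf_C_mul_le _ _ _).trans ?_
  refine (MvPolynomial.degreeOf_prod_le _ _ _).trans ?_
  refine (Finset.sum_le_card_nsmul _ _ (a * e) fun b _ => ?_).trans (by simp)
  refine (MvPolynomial.degreeOf_pow_le _ _ _).trans ?_
  exact Nat.mul_le_mul (MvPolynomial.degreeOf_le_iff.1 (hP b) m hm) (hG b)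

theorem degreeOf_genFS_le (hd : 0 < d) (hw : 0 < w) (hβ : Function.Injective β)
    (b : Fin n → Fin 2) (j : Fin (n + 1)) :
    (genFS w d ω β b).degreeOf j ≤ w ^ 2 * (2 ^ (n - 1) * d * w ^ 2) := by
  classical
  set k := 2 ^ (n - 1) * d * w ^ 2 with hk
  have hk0 : 0 < k := by positivity
  have hinterp : ∀ (ℓ : Fin n → Fin (w ^ 2)) i, (interp w β ℓ i).natDegree ≤ w ^ 2 := by
    intro ℓ i
    have : 1 ≤ w ^ 2 := Nat.one_le_pow _ _ hw
    refine (natDegree_interp_le w β hβ ℓ i).trans ?_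
    split_ifs <;> omega
  have hpoint : ∀ (ℓ : Fin n → Fin (w ^ 2)) i,
      (point w ω ℓ i).degreeOf j ≤ if j = i.castSucc then 1 else 0 := by
    intro ℓ i
    refine (MvPolynomial.degreeOf_C_mul_le _ _ _).trans ?_
    rw [MvPolynomial.degreeOf_X]
  have hfactor : ∀ (ℓ : Fin n → Fin (w ^ 2)) (i : Fin n), MvPolynomial.degreeOf j
      ((1 - ((b i : ℕ) : MvPolynomial (Fin (n + 1)) F)) * loTerm w ω β ℓ i
      + ((b i : ℕ) : MvPolynomial (Fin (n + 1)) F) * hiTerm w d ω β ℓ i) ≤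
      if j = i.castSucc then w ^ 2 * k else 0 := by
    intro ℓ i
    have hb : b i = 0 ∨ b i = 1 := by
      generalize b i = c
      fin_cases c <;> simp
    have hlo : (loTerm w ω β ℓ i).degreeOf j ≤ if j = i.castSucc then w ^ 2 * k else 0 := by
      refine (degreeOf_aeval_le _ _ _).trans ((Nat.mul_le_mul (hinterp _ _) (hpoint ℓ i)).trans ?_)
      split_ifs
      · exact Nat.mul_le_mul_left _ hk0
      · simp
    have hik : 2 ^ (i : ℕ) * d * w ^ 2 ≤ k :=
      Nat.mul_le_mul_right _ (Nat.mul_le_mul_right _ (Nat.pow_le_pow_right two_pos (by omega)))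
    have hhi : (hiTerm w d ω β ℓ i).degreeOf j ≤ if j = i.castSucc then w ^ 2 * k else 0 := by
      refine (degreeOf_aeval_le _ _ _).trans ?_
      refine (Nat.mul_le_mul (hinterp _ _) ((MvPolynomial.degreeOf_pow_le _ _ _).trans
        (Nat.mul_le_mul hik (hpoint ℓ i)))).trans ?_
      split_ifs <;> simp
    rcases hb with hb | hb
    · simpa [hb] using hlo
    · simpa [hb] using hhi
  refine (MvPolynomial.degreeOf_sum_le _ _ _).trans (Finset.sup_le fun ℓ _ => ?_)
  refine (MvPolynomial.degreeOf_mul_le _ _ _).trans ?_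
  have hlast : (lastTerm w β ℓ).degreeOf j ≤ if j = Fin.last n then w ^ 2 * k else 0 := by
    refine (degreeOf_aeval_le _ _ _).trans ((Nat.mul_le_mul_right _ (hinterp _ _)).trans ?_)
    rw [MvPolynomial.degreeOf_X]
    split_ifs
    · exact Nat.mul_le_mul_left _ hk0
    · simp
  calc _ ≤ (∑ i : Fin n, if j = i.castSucc then w ^ 2 * k else 0) +
        if j = Fin.last n then w ^ 2 * k else 0 :=
        Nat.add_le_add ((MvPolynomial.degreeOf_prod_le _ _ _).trans
          (Finset.sum_le_sum fun i _ => hfactor ℓ i)) hlast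
    _ = ∑ i : Fin (n + 1), if j = i then w ^ 2 * k else 0 := by rw [Fin.sum_univ_castSucc]
    _ = w ^ 2 * k := by simp

/-- By the combinatorial Nullstellensatz, the point can be taken with coordinates among the `T`
distinct powers of `ω`. -/
theorem exists_eval_ne_zero_of_degreeOf_lt {τ : Type*} [Finite τ] {T : ℕ}
    (hω : Set.InjOn (fun m : ℕ => ω ^ m) (Set.Iio T)) {Q : MvPolynomial τ F} (hQ : Q ≠ 0)
    (hdeg : ∀ j, Q.degreeOf j < T) : ∃ α, MvPolynomial.eval α Q ≠ 0 := by
  classical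
  by_contra! h
  refine hQ (MvPolynomial.eq_zero_of_eval_zero_at_prod_finset Q
    (fun _ => (Finset.range T).image fun m => ω ^ m) (fun j => ?_) fun x _ => h x)
  rw [Finset.card_image_of_injOn (by simpa using hω), Finset.card_range]
  exact hdeg j

theorem eq_C_of_mem_roABPClass_zero {m : ℕ} {V : Type*} {ord : Fin m ≃ V} {P : MvPolynomial V F}
    (hP : P ∈ roABPClass F w 0 ord) : ∃ c, P = MvPolynomial.C c := by
  refine ⟨_, MvPolynomial.totalDegree_eq_zero_iff_eq_C.1 ?_⟩
  rw [MvPolynomial.totalDegree_eq_zero_iff]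
  intro s hs j
  exact Nat.le_zero.1 (MvPolynomial.degreeOf_le_iff.1 (degreeOf_le_of_mem_roABPClass hP j) s hs)

theorem isGenerator_genFS (hw : 0 < w) (hω0 : ω ≠ 0)
    (hω : Set.InjOn (fun m : ℕ => ω ^ m) (Set.Iio ((2 ^ n * d * w ^ 2) ^ 2)))
    (hβ : Function.Injective β) :
    IsGenerator (roABPClass F w d (monomialOrder (Equiv.refl (Fin n)))) (genFS w d ω β) := by
  refine fun P hP => ⟨fun hP0 => ?_, fun h hP0 => h (by rw [hP0, map_zero])⟩
  -- For `d = 0` the order of `ω` is unconstrained, but the program is constant.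
  rcases Nat.eq_zero_or_pos d with rfl | hd
  · obtain ⟨c, rfl⟩ := eq_C_of_mem_roABPClass_zero hP
    simpa using hP0
  · exact bind₁_genFS_ne_zero hd hw hω0 hω hβ hP hP0

theorem exists_eval_genFS_ne_zero (hn : 0 < n) (hw : 0 < w) (hω0 : ω ≠ 0)
    (hω : Set.InjOn (fun m : ℕ => ω ^ m) (Set.Iio ((2 ^ n * d * w ^ 2) ^ 2)))
    (hβ : Function.Injective β) {P : MvPolynomial (Fin n → Fin 2) F}
    (hP : P ∈ roABPClass F w d (monomialOrder (Equiv.refl (Fin n)))) (hP0 : P ≠ 0) :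
    ∃ α : Fin (n + 1) → F,
      MvPolynomial.eval (fun b => MvPolynomial.eval α (genFS w d ω β b)) P ≠ 0 := by
  rcases Nat.eq_zero_or_pos d with rfl | hd
  · obtain ⟨c, rfl⟩ := eq_C_of_mem_roABPClass_zero hP
    exact ⟨0, by simpa using hP0⟩
  · obtain ⟨α, hα⟩ := exists_eval_ne_zero_of_degreeOf_lt hω
      (((isGenerator_genFS hw hω0 hω hβ) P hP).1 hP0) (fun j => by
        refine (degreeOf_bind₁_le (degreeOf_le_of_mem_roABPClass hP)
          (fun b => degreeOf_genFS_le hd hw hβ b j)).trans_lt ?_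
        obtain ⟨n, rfl⟩ := Nat.exists_eq_add_one.2 hn
        have hpos : 0 < 2 ^ n * d * w ^ 2 := by positivity
        calc Fintype.card (Fin (n + 1) → Fin 2) * (d * (w ^ 2 * (2 ^ (n + 1 - 1) * d * w ^ 2)))
            = 2 * (2 ^ n * d * w ^ 2) ^ 2 := by simp; ring
          _ < 4 * (2 ^ n * d * w ^ 2) ^ 2 := Nat.mul_lt_mul_of_pos_right (by norm_num)
            (by positivity)
          _ = (2 ^ (n + 1) * d * w ^ 2) ^ 2 := by ring)
    refine ⟨α, fun h => hα ?_⟩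
    rw [← h, ← MvPolynomial.coe_aeval_eq_eval, RingHom.coe_coe, MvPolynomial.aeval_bind₁,
      ← MvPolynomial.coe_aeval_eq_eval, RingHom.coe_coe]

end Degrees

/-! ### Permuted orders and succinct hitting sets -/

section Permuted

variable {F : Type*} [Field F] {n w d : ℕ} {ω : F} {β : Fin (w ^ 2) → F}

theorem ROABP.poly_trans {m : ℕ} {V W : Type*} (B : ROABP F m) (ord : Fin m ≃ V) (e : V ≃ W) :
    B.poly (ord.trans e) = MvPolynomial.rename e (B.poly ord) := by
  simp only [ROABP.poly, map_sum, map_prod, ← Polynomial.aeval_algHom_apply,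
    MvPolynomial.rename_X, Equiv.trans_apply]

theorem mem_roABPClass_trans {m : ℕ} {V W : Type*} {ord : Fin m ≃ V} (e : V ≃ W)
    {P : MvPolynomial W F} : P ∈ roABPClass F w d (ord.trans e) ↔
      ∃ Q ∈ roABPClass F w d ord, MvPolynomial.rename e Q = P := by
  constructor
  · rintro ⟨B, hB, hd, rfl⟩
    exact ⟨_, ⟨B, hB, hd, rfl⟩, (B.poly_trans ord e).symm⟩
  · rintro ⟨_, ⟨B, hB, hd, rfl⟩, rfl⟩
    exact ⟨B, hB, hd, B.poly_trans ord e⟩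

theorem coeffVec_rename (σ : Equiv.Perm (Fin n)) (f : MvPolynomial (Fin n) F)
    (b : Fin n → Fin 2) :
    coeffVec (MvPolynomial.rename σ f) (Equiv.arrowCongr σ (Equiv.refl (Fin 2)) b) =
      coeffVec f b := by
  rw [coeffVec, coeffVec, ← MvPolynomial.coeff_rename_mapDomain σ σ.injective f (expo b)]
  congr 1
  ext i
  simp [expo, Finsupp.mapDomain_equiv_apply]

theorem polyFSAt_mem_roABPClass (hn : 0 < n) (hw : 0 < w) (σ : Equiv.Perm (Fin n))
    (α : Fin (n + 1) → F) : polyFSAt w d ω β σ α ∈ roABPClass F (w ^ 2) 1 σ :=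
  (mem_roABPClass_trans (ord := Equiv.refl (Fin n)) σ).2
    ⟨_, map_polyFS_mem_roABPClass d ω β hn hw α, rfl⟩

theorem exists_eval_polyFSAt_ne_zero (hn : 0 < n) (hw : 0 < w) (hω0 : ω ≠ 0)
    (hω : Set.InjOn (fun m : ℕ => ω ^ m) (Set.Iio ((2 ^ n * d * w ^ 2) ^ 2)))
    (hβ : Function.Injective β) (σ : Equiv.Perm (Fin n)) {P : MvPolynomial (Fin n → Fin 2) F}
    (hP : P ∈ roABPClass F w d (monomialOrder σ)) (hP0 : P ≠ 0) :
    ∃ α : Fin (n + 1) → F, MvPolynomial.eval (coeffVec (polyFSAt w d ω β σ α)) P ≠ 0 := by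
  obtain ⟨Q, hQ, rfl⟩ := (mem_roABPClass_trans (ord := monomialOrder (Equiv.refl (Fin n)))
    (Equiv.arrowCongr σ (Equiv.refl (Fin 2)))).1 hP
  obtain ⟨α, hα⟩ := exists_eval_genFS_ne_zero hn hw hω0 hω hβ hQ
    (fun h => hP0 (by rw [h, map_zero]))
  refine ⟨α, ?_⟩
  rw [MvPolynomial.eval_rename]
  convert hα using 3
  funext b
  exact (coeffVec_rename σ _ b).trans (coeffVec_map_polyFS w d ω β α b)

theorem isSuccinctHittingSet_of_exists {C : Set (MvPolynomial (Fin n) F)}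
    {D : Set (MvPolynomial (Fin n → Fin 2) F)}
    (hC : ∀ f ∈ C, f ∈ MvPolynomial.restrictDegree (Fin n) F 1)
    (h : ∀ P ∈ D, P ≠ 0 → ∃ f ∈ C, MvPolynomial.eval (coeffVec f) P ≠ 0) :
    IsSuccinctHittingSet C D := by
  refine ⟨hC, fun P hP => ⟨h P hP, ?_⟩⟩
  rintro ⟨f, -, hf⟩ rfl
  exact hf (map_zero _)

/-- The class of all branching programs of width `w ^ 2` and degree `1` hits: if `d = 0` any
member of the class does, and otherwise the powers of `ω` provide interpolation nodes, so that the
generator applies. -/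
theorem exists_roABP_eval_ne_zero (hn : 0 < n) (hw : 0 < w) (hω0 : ω ≠ 0)
    (hω : Set.InjOn (fun m : ℕ => ω ^ m) (Set.Iio ((2 ^ n * d * w ^ 2) ^ 2)))
    (σ : Equiv.Perm (Fin n)) {P : MvPolynomial (Fin n → Fin 2) F}
    (hP : P ∈ roABPClass F w d (monomialOrder σ)) (hP0 : P ≠ 0) :
    ∃ f ∈ roABPClass F (w ^ 2) 1 σ, MvPolynomial.eval (coeffVec f) P ≠ 0 := by
  rcases Nat.eq_zero_or_pos d with rfl | hd
  · obtain ⟨c, rfl⟩ := eq_C_of_mem_roABPClass_zero hP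
    exact ⟨_, listProd_mem_roABPClass (pow_pos hw 2) σ (fun _ => 0) (by simp), by simpa using hP0⟩
  · have hβ : Function.Injective fun m : Fin (w ^ 2) => ω ^ (m : ℕ) := by
      have hle : w ^ 2 ≤ (2 ^ n * d * w ^ 2) ^ 2 := by
        have h1 : 0 < 2 ^ n * d := by positivity
        exact (Nat.le_mul_of_pos_left _ h1).trans (Nat.le_self_pow two_ne_zero _)
      exact fun a b hab => Fin.ext (hω (a.2.trans_le hle) (b.2.trans_le hle) hab)
    obtain ⟨α, hα⟩ := exists_eval_polyFSAt_ne_zero hn hw hω0 hω hβ σ hP hP0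
    exact ⟨_, polyFSAt_mem_roABPClass hn hw σ α, hα⟩

end Permuted

theorem injOn_pow_of_order_ge {F : Type*} [Field F] {ω : Fˣ} {T : ℕ}
    (hω : ∀ k : ℕ, 0 < k → ω ^ k = 1 → T ≤ k) :
    Set.InjOn (fun m : ℕ => (ω : F) ^ m) (Set.Iio T) := by
  have key : ∀ a b : ℕ, a < b → b < T → (ω : F) ^ a ≠ (ω : F) ^ b := by
    intro a b hab hb h
    have h1 : ω ^ a = ω ^ b := Units.ext (by simpa using h)
    have h2 := hω (b - a) (by omega) (by rw [pow_sub ω hab.le, ← h1, mul_inv_cancel])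
    omega
  intro a ha b hb hab
  rcases lt_trichotomy a b with h | h | h
  · exact (key a b h hb hab).elim
  · exact h
  · exact (key b a h ha hab.symm).elim

end SuccinctROABP

theorem mainTheorem6 {F : Type*} [Field F] (n w d : ℕ) (hn : 0 < n) (hw : 0 < w) (ω : Fˣ)
    (hω : ∀ k : ℕ, 0 < k → ω ^ k = 1 → (2 ^ n * d * w ^ 2) ^ 2 ≤ k) :
    (∀ β : Fin (w ^ 2) → F, Function.Injective β →
      SuccinctROABP.coeffVec (SuccinctROABP.polyFS w d (ω : F) β)
        = SuccinctROABP.genFS (n := n) w d (ω : F) β ∧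
      SuccinctROABP.polyFS w d (ω : F) β
        = SuccinctROABP.ofCoeffVec (SuccinctROABP.genFS (n := n) w d (ω : F) β) ∧
      (∀ α : Fin (n + 1) → F,
        MvPolynomial.map (MvPolynomial.eval α) (SuccinctROABP.polyFS w d (ω : F) β)
          ∈ SuccinctROABP.roABPClass F (w ^ 2) 1 (Equiv.refl (Fin n))) ∧
      SuccinctROABP.IsSuccinctGenerator
        (SuccinctROABP.roABPClass F (w ^ 2) 1 (Equiv.refl (Fin n)))
        (SuccinctROABP.roABPClass F w d (SuccinctROABP.monomialOrder (Equiv.refl (Fin n))))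
        (SuccinctROABP.genFS w d (ω : F) β) ∧
      (∀ σ : Equiv.Perm (Fin n),
        (∀ α : Fin (n + 1) → F, SuccinctROABP.polyFSAt w d (ω : F) β σ α
          ∈ SuccinctROABP.roABPClass F (w ^ 2) 1 σ) ∧
        SuccinctROABP.IsSuccinctHittingSet
          {f | ∃ α : Fin (n + 1) → F, f = SuccinctROABP.polyFSAt w d (ω : F) β σ α}
          (SuccinctROABP.roABPClass F w d (SuccinctROABP.monomialOrder σ))) ∧
      SuccinctROABP.IsSuccinctHittingSet
        {f | ∃ (σ : Equiv.Perm (Fin n)) (α : Fin (n + 1) → F),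
          f = SuccinctROABP.polyFSAt w d (ω : F) β σ α}
        {P | ∃ ord : Fin (2 ^ n) ≃ (Fin n → Fin 2), SuccinctROABP.IsMonomialCompatible ord ∧
          P ∈ SuccinctROABP.roABPClass F w d ord}) ∧
    SuccinctROABP.IsSuccinctHittingSet
      (SuccinctROABP.roABPClass F (w ^ 2) 1 (Equiv.refl (Fin n)))
      (SuccinctROABP.roABPClass F w d (SuccinctROABP.monomialOrder (Equiv.refl (Fin n)))) ∧
    SuccinctROABP.IsSuccinctHittingSet
      {f | ∃ σ : Equiv.Perm (Fin n), f ∈ SuccinctROABP.roABPClass F (w ^ 2) 1 σ}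
      {P | ∃ ord : Fin (2 ^ n) ≃ (Fin n → Fin 2), SuccinctROABP.IsMonomialCompatible ord ∧
        P ∈ SuccinctROABP.roABPClass F w d ord} := by
  have hω0 : (ω : F) ≠ 0 := ω.ne_zero
  have hinj := SuccinctROABP.injOn_pow_of_order_ge hω
  refine ⟨fun β hβ => ⟨?_, ?_, ?_, ⟨?_, ?_, ?_⟩, fun σ => ⟨?_, ?_⟩, ?_⟩, ?_, ?_⟩
  · rw [SuccinctROABP.polyFS_eq_ofCoeffVec, SuccinctROABP.coeffVec_ofCoeffVec]
  · exact SuccinctROABP.polyFS_eq_ofCoeffVec w d _ β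
  · exact SuccinctROABP.map_polyFS_mem_roABPClass d _ β hn hw
  · exact fun f hf => SuccinctROABP.mem_restrictDegree_of_mem_roABPClass hf
  · intro α
    rw [← SuccinctROABP.polyFS_eq_ofCoeffVec]
    exact SuccinctROABP.map_polyFS_mem_roABPClass d _ β hn hw α
  · exact SuccinctROABP.isGenerator_genFS hw hω0 hinj hβ
  · exact SuccinctROABP.polyFSAt_mem_roABPClass hn hw σ
  · refine SuccinctROABP.isSuccinctHittingSet_of_exists ?_ fun P hP hP0 => ?_
    · rintro _ ⟨α, rfl⟩
      exact SuccinctROABP.mem_restrictDegree_of_mem_roABPClass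
        (SuccinctROABP.polyFSAt_mem_roABPClass hn hw σ α)
    · obtain ⟨α, hα⟩ := SuccinctROABP.exists_eval_polyFSAt_ne_zero hn hw hω0 hinj hβ σ hP hP0
      exact ⟨_, ⟨α, rfl⟩, hα⟩
  · refine SuccinctROABP.isSuccinctHittingSet_of_exists ?_ ?_
    · rintro _ ⟨σ, α, rfl⟩
      exact SuccinctROABP.mem_restrictDegree_of_mem_roABPClass
        (SuccinctROABP.polyFSAt_mem_roABPClass hn hw σ α)
    · rintro P ⟨_, ⟨σ, rfl⟩, hP⟩ hP0
      obtain ⟨α, hα⟩ := SuccinctROABP.exists_eval_polyFSAt_ne_zero hn hw hω0 hinj hβ σ hP hP0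
      exact ⟨_, ⟨σ, α, rfl⟩, hα⟩
  · exact SuccinctROABP.isSuccinctHittingSet_of_exists
      (fun f hf => SuccinctROABP.mem_restrictDegree_of_mem_roABPClass hf)
      fun P hP hP0 => SuccinctROABP.exists_roABP_eval_ne_zero hn hw hω0 hinj _ hP hP0
  · refine SuccinctROABP.isSuccinctHittingSet_of_exists ?_ ?_
    · rintro f ⟨σ, hf⟩
      exact SuccinctROABP.mem_restrictDegree_of_mem_roABPClass hf
    · rintro P ⟨_, ⟨σ, rfl⟩, hP⟩ hP0
      obtain ⟨f, hf, hfP⟩ := SuccinctROABP.exists_roABP_eval_ne_zero hn hw hω0 hinj σ hP hP0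
      exact ⟨f, ⟨σ, hf⟩, hfP⟩
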